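/- Let $K$ be a $p$-field (nonarchimedean local field) with ring of integers $R$ and residue field of cardinality $q$. Let $\mu$ be the additive Haar measure on $K$ with $\mu(R)=1$, let $|x|=\mu(xR)$ be the canonical absolute value, and for $N\ge 2$ put $\|x\|=\max_i|x_i|$ on $K^N$, with product Haar measure $|dx|$. Suppose $q\geq N$, let $a,b\in\mathbb{C}$ satisfy $\mathrm{Re}\,b\geq -1$ and $\mathrm{Re}(a+b)\geq 1-N$, and let $q_1,\dots,q_N>0$. Let $\mathcal{N}=\{0\}\cup\bigcup_{n\ge1}\{n,\tfrac1n\}$ (which contains $\|K^N\|=\{0\}\cup q^{\mathbb{Z}}$), and let $\rho:\mathcal{N}\to[0,\infty)$ satisfy $$\limsup_{n\to\infty}\frac{\log\rho(1/n)}{\log n}\leq 1,\qquad \limsup_{n\to\infty}\frac{\log\rho(n)}{\log n}=-\infty\qquad(\log 0:=-\infty).$$ Assume that $x\mapsto\rho(\|x\|)$ has compact support in $K^N$, that $\rho(q^m)\neq0$ for some $m\in\mathbb{Z}$, and let $M$ be the largest integer with $\rho(q^M)\neq 0$. Then for every $\beta>0$ the partition function $$\mathcal{Z}_N(\beta)=\int_{K^N}\rho(\|x\|)\prod_{i<j}|x_i-x_j|^{q_iq_j\beta}\,|dx|$$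 is positive and finite, so that $\frac{1}{\mathcal{Z}_N(\beta)}\rho(\|x\|)\prod_{i<j}|x_i-x_j|^{q_iq_j\beta}\,|dx|$ is a probability measure on $K^N$; the function $(\max_{i<j}|x_i-x_j|)^a(\min_{i<j}|x_i-x_j|)^b$ is integrable with respect to it; and its expected value $\mathbb{E}$ with respect to it satisfies $$\lim_{\beta\to\infty}\mathbb{E}\Big[\big(\max_{i<j}|x_i-x_j|\big)^a\big(\min_{i<j}|x_i-x_j|\big)^b\Big]=q^{M(a+b)}.$$ -/

import Mathlib

open MeasureTheory Filter Topology
open scoped ValuativeRel ENNReal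

namespace LogCoulombGas

noncomputable section

section PField

variable (K : Type*) [Field K] [ValuativeRel K] [TopologicalSpace K]
  [IsNonarchimedeanLocalField K]

/-- The cardinality `q` of the residue field of the `p`-field `K`. -/
def residueCard : ℕ := Nat.card 𝓀[K]

/-- The ring of integers `R` of `K`, as a compact set with nonempty interior. -/
def integerCompacts : TopologicalSpace.PositiveCompacts K where
  carrier := (𝒪[K] : Set K)
  isCompact' := IsNonarchimedeanLocalField.isCompact_closedBall K 1
  interior_nonempty' := by
    have h : IsOpen (𝒪[K] : Set K) := by
      let := IsTopologicalAddGroup.rightUniformSpace K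
      have := isUniformAddGroup_of_addCommGroup (G := K)
      exact Valued.isOpen_integer K
    exact ⟨0, by rw [h.interior_eq]; exact 𝒪[K].zero_mem⟩

variable [MeasurableSpace K] [BorelSpace K]

/-- The additive Haar measure `μ` on `K`, normalized by `μ(R) = 1`. -/
def haar : Measure K := Measure.addHaarMeasure (integerCompacts K)

variable {K}

/-- The canonical absolute value on `K`: `|x| = μ(xR) / μ(R)`. -/
def absVal (x : K) : ℝ :=
  (haar K ((fun y => x * y) '' (𝒪[K] : Set K)) / haar K (𝒪[K] : Set K)).toReal

variable {N : ℕ}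

/-- The standard norm `‖x‖ = max_i |x_i|` on `K^N`. -/
def stdNorm (x : Fin N → K) : ℝ := ⨆ i, absVal (x i)

/-- The diameter `max_{i<j} |x_i - x_j|`. -/
def maxDist (x : Fin N → K) : ℝ :=
  ⨆ p : {p : Fin N × Fin N // p.1 < p.2}, absVal (x p.1.1 - x p.1.2)

/-- The minimum distance `min_{i<j} |x_i - x_j|`. -/
def minDist (x : Fin N → K) : ℝ :=
  ⨅ p : {p : Fin N × Fin N // p.1 < p.2}, absVal (x p.1.1 - x p.1.2)

/-- The unnormalized density `ρ(‖x‖) ∏_{i<j} |x_i - x_j|^(q_i q_j β)` of the gas with charges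
`c i = q_i`. -/
def weight (ρ : ℝ → ℝ) (c : Fin N → ℝ) (β : ℝ) (x : Fin N → K) : ℝ :=
  ρ (stdNorm x) * ∏ i, ∏ j ∈ Finset.Ioi i, absVal (x i - x j) ^ (c i * c j * β)

variable (K)

/-- The canonical partition function `Z_N(β)`. -/
def partitionFunction (ρ : ℝ → ℝ) (c : Fin N → ℝ) (β : ℝ) : ℝ≥0∞ :=
  ∫⁻ x : Fin N → K, ENNReal.ofReal (weight ρ c β x) ∂(Measure.pi fun _ => haar K)

/-- The law of the microstate `x ∈ K^N` of the log-Coulomb gas: the measure with density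
`Z_N(β)⁻¹ ρ(‖x‖) ∏_{i<j} |x_i - x_j|^(q_i q_j β)` with respect to Haar measure. -/
def gasLaw (ρ : ℝ → ℝ) (c : Fin N → ℝ) (β : ℝ) : Measure (Fin N → K) :=
  (partitionFunction K ρ c β)⁻¹ •
    (Measure.pi fun _ => haar K).withDensity fun x => ENNReal.ofReal (weight ρ c β x)

end PField

/-- The set `{0} ∪ {n, 1/n : n ≥ 1}`, which contains the range of the standard norm for every
`p`-field and every `N`. -/
def normValues : Set ℝ := {0} ∪ ⋃ n ∈ Set.Ici (1 : ℕ), {(n : ℝ), 1 / (n : ℝ)}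

/-- The growth and decay conditions `limsup log|ρ(1/n)| / log n ≤ 1` and
`limsup log|ρ(n)| / log n = -∞`, with the extended logarithm, `log 0 = -∞`. -/
def MildGrowth (ρ : ℝ → ℝ) : Prop :=
  limsup (fun n : ℕ => ENNReal.log (ENNReal.ofReal |ρ (1 / (n : ℝ))|) / (Real.log n : EReal))
      atTop ≤ 1 ∧
    limsup (fun n : ℕ => ENNReal.log (ENNReal.ofReal |ρ (n : ℝ)|) / (Real.log n : EReal))
      atTop = ⊥

end

end LogCoulombGas

/-! Put B = q^M. For almost every x with ρ(‖x‖) ≠ 0 the norm is a power of q, so ‖x‖ ≤ B and, by the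
ultrametric inequality, every |x_i - x_j| ≤ B. There the weight is A^β ρ(‖x‖) P(x)^β with A
independent of x and P = `scaledProd` in [0, 1] (`weight_eq`), and P = 1 exactly when all mutual
distances equal B (`scaledProd_eq_one_iff`). As β → ∞, P^β tends to the indicator of this
`spreadSet`, which is open, and nonempty because N ≤ q; on it the norm, the diameter and the minimum
distance all equal B. Dominated convergence (`tendsto_integral_scaled`), for the given exponents and
for a = b = 0, yields the limits of numerator and denominator. The factor A^β, the volume of the set
and ρ(B) cancel, leaving B^(a+b).

The analytic point is integrability at the borderline exponents (`exists_norm_mul_le`). With s ≥ d ≥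
τ the norm, diameter and minimum distance divided by B, the observable is at most a constant times
d^(2-N) τ^(-1), and ρ at most a constant times s^(-1-γ) for any γ > 0. The total homogeneity is
about -N, just short of integrable. But P^β ≤ τ^δ for some δ > 0, and since τ is the smallest scale
this gain can be shared out, giving all N factors the exponent γ - 1 > -1. Choosing a closest pair
(i, j) and taking the differences x_k - x_j as coordinates (`shear`), the result is dominated by a
product of one-variable integrable functions. -/

namespace LogCoulombGas

/-! ### The canonical absolute value: ultrametric inequality, value group, measurability. -/

section AbsoluteValue

open scoped Pointwise

variable (K : Type*) [Field K] [ValuativeRel K] [TopologicalSpace K]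
  [IsNonarchimedeanLocalField K]

/-- The valuation has rank one, so K is a locally compact, hence proper, normed field. This makes
Haar measure σ-finite and Borel sets compatible with products. -/
theorem secondCountableTopology : SecondCountableTopology K := by
  let := IsTopologicalAddGroup.rightUniformSpace K
  have := isUniformAddGroup_of_addCommGroup (G := K)
  let : (Valued.v (R := K)).RankOne :=
  { hom' := ValuativeRel.IsRankLeOne.nonempty.some.emb (R := K).comp
      MonoidWithZeroHom.ValueGroup₀.embedding
    strictMono' := ValuativeRel.IsRankLeOne.nonempty.some.strictMono.comp
        MonoidWithZeroHom.ValueGroup₀.embedding_strictMono }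
  open scoped Valued in
  have : ProperSpace K := .of_nontriviallyNormedField_of_weaklyLocallyCompactSpace K
  open scoped Valued in
  exact secondCountable_of_proper

theorem nhdsNE_zero_neBot : (𝓝[≠] (0 : K)).NeBot := by
  let := IsTopologicalAddGroup.rightUniformSpace K
  have := isUniformAddGroup_of_addCommGroup (G := K)
  let : (Valued.v (R := K)).RankOne :=
  { hom' := ValuativeRel.IsRankLeOne.nonempty.some.emb (R := K).comp
      MonoidWithZeroHom.ValueGroup₀.embedding
    strictMono' := ValuativeRel.IsRankLeOne.nonempty.some.strictMono.comp
        MonoidWithZeroHom.ValueGroup₀.embedding_strictMono }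
  open scoped Valued in
  exact NormedField.nhdsNE_neBot 0

theorem isOpen_integer : IsOpen (𝒪[K] : Set K) := by
  let := IsTopologicalAddGroup.rightUniformSpace K
  have := isUniformAddGroup_of_addCommGroup (G := K)
  exact Valued.isOpen_integer K

theorem isCompact_integer : IsCompact (𝒪[K] : Set K) :=
  IsNonarchimedeanLocalField.isCompact_closedBall K 1

theorem t2Space : T2Space K := by
  let := IsTopologicalAddGroup.rightUniformSpace K
  have := isUniformAddGroup_of_addCommGroup (G := K)
  infer_instance

theorem one_lt_residueCard : 1 < residueCard K := Finite.one_lt_card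

variable [MeasurableSpace K] [BorelSpace K]

instance : (haar K).IsAddHaarMeasure := by unfold haar; infer_instance

instance : (haar K).Regular := by unfold haar; infer_instance

theorem haar_integer : haar K (𝒪[K] : Set K) = 1 :=
  Measure.addHaarMeasure_self (K₀ := integerCompacts K)

instance : NullSingletonClass (haar K) := by
  have := nhdsNE_zero_neBot K
  have := t2Space K
  infer_instance

instance : SigmaFinite (haar K) := by
  have := secondCountableTopology K
  infer_instance

variable {K}

theorem absVal_eq (x : K) : absVal x = (haar K ((fun y => x * y) '' (𝒪[K] : Set K))).toReal := by
  simp [absVal, haar_integer]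

/-- Multiplication by a unit scales Haar measure by its modulus, and 𝒪 has measure 1. Positivity and
multiplicativity of `absVal` are inherited from this character. -/
theorem absVal_unit (u : Kˣ) : absVal (u : K) = distribHaarChar K u := by
  rw [absVal_eq]
  have := distribHaarChar_mul (haar K) u (𝒪[K] : Set K)
  rw [haar_integer, mul_one] at this
  have h : (fun y => (u : K) * y) '' (𝒪[K] : Set K) = u • (𝒪[K] : Set K) := rfl
  rw [h, ← this]
  rfl

theorem absVal_zero : absVal (0 : K) = 0 := by
  rw [absVal_eq]
  have : (fun y : K => 0 * y) '' (𝒪[K] : Set K) ⊆ {0} := by rintro _ ⟨y, -, rfl⟩; simp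
  have h := measure_mono (μ := haar K) this
  rw [measure_singleton] at h
  rw [le_antisymm h (by simp), ENNReal.toReal_zero]

theorem absVal_pos {x : K} (hx : x ≠ 0) : 0 < absVal x := by
  lift x to Kˣ using hx.isUnit
  rw [absVal_unit]
  exact_mod_cast distribHaarChar_pos

theorem absVal_nonneg (x : K) : 0 ≤ absVal x := ENNReal.toReal_nonneg

theorem absVal_eq_zero {x : K} : absVal x = 0 ↔ x = 0 :=
  ⟨fun h => by_contra fun hx => (absVal_pos hx).ne' h, fun h => h ▸ absVal_zero⟩

theorem absVal_mul (x y : K) : absVal (x * y) = absVal x * absVal y := by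
  rcases eq_or_ne x 0 with rfl | hx
  · simp [absVal_zero]
  rcases eq_or_ne y 0 with rfl | hy
  · simp [absVal_zero]
  lift x to Kˣ using hx.isUnit
  lift y to Kˣ using hy.isUnit
  rw [← Units.val_mul, absVal_unit, absVal_unit, absVal_unit, map_mul]
  push_cast
  rfl

variable (K) in
/-- The canonical absolute value as a monoid homomorphism. -/
noncomputable def absValHom : K →*₀ ℝ where
  toFun := absVal
  map_zero' := absVal_zero
  map_one' := by simpa using absVal_unit (1 : Kˣ)
  map_mul' := absVal_mul

theorem absVal_one : absVal (1 : K) = 1 := map_one (absValHom K)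

theorem absVal_inv (x : K) : absVal x⁻¹ = (absVal x)⁻¹ := map_inv₀ (absValHom K) x

theorem absVal_zpow (x : K) (n : ℤ) : absVal (x ^ n) = absVal x ^ n := map_zpow₀ (absValHom K) x n

theorem absVal_pow (x : K) (n : ℕ) : absVal (x ^ n) = absVal x ^ n := map_pow (absValHom K) x n

theorem absVal_le_one_of_mem {x : K} (hx : x ∈ 𝒪[K]) : absVal x ≤ 1 := by
  rw [absVal_eq]
  have h : (fun y => x * y) '' (𝒪[K] : Set K) ⊆ 𝒪[K] := by
    rintro _ ⟨y, hy, rfl⟩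
    exact mul_mem hx hy
  have := measure_mono (μ := haar K) h
  rw [haar_integer] at this
  exact ENNReal.toReal_le_of_le_ofReal zero_le_one (by simpa using this)

theorem absVal_eq_one_of_isUnit {u : 𝒪[K]} (hu : IsUnit u) : absVal (u : K) = 1 := by
  obtain ⟨u, rfl⟩ := hu
  have h1 := absVal_le_one_of_mem (u : 𝒪[K]).2
  have h2 := absVal_le_one_of_mem (↑u⁻¹ : 𝒪[K]).2
  have h3 : ((u : 𝒪[K]) : K) * ((↑u⁻¹ : 𝒪[K]) : K) = 1 := by
    have : (u : 𝒪[K]) * (↑u⁻¹ : 𝒪[K]) = 1 := u.mul_inv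
    exact_mod_cast congrArg (Subtype.val) this
  have h4 := absVal_mul ((u : 𝒪[K]) : K) ((↑u⁻¹ : 𝒪[K]) : K)
  rw [h3, absVal_one] at h4
  nlinarith [absVal_nonneg ((u : 𝒪[K]) : K), absVal_nonneg ((↑u⁻¹ : 𝒪[K]) : K)]

theorem absVal_neg (x : K) : absVal (-x) = absVal x := by
  have : absVal (-1 : K) = 1 := absVal_eq_one_of_isUnit (u := (-1 : 𝒪[K])) (isUnit_neg_one)
  rw [← neg_one_mul, absVal_mul, this, one_mul]

theorem absVal_sub_comm (x y : K) : absVal (x - y) = absVal (y - x) := by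
  rw [← absVal_neg, neg_sub]

/-- The maximal ideal has index `q`: the absolute value of a uniformizer is `q⁻¹`. -/
theorem absVal_irreducible {ϖ : 𝒪[K]} (hϖ : Irreducible ϖ) :
    absVal (ϖ : K) = (residueCard K : ℝ)⁻¹ := by
  have hϖ0 : (ϖ : K) ≠ 0 := by simpa using hϖ.ne_zero
  let r : 𝓀[K] → 𝒪[K] := Function.surjInv IsLocalRing.residue_surjective
  have hr : ∀ a, IsLocalRing.residue 𝒪[K] (r a) = a :=
    Function.surjInv_eq IsLocalRing.residue_surjective
  let P : Set K := (fun y => (ϖ : K) * y) '' (𝒪[K] : Set K)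
  have hP : MeasurableSet P := by
    have : P = (fun y => (ϖ : K)⁻¹ * y) ⁻¹' (𝒪[K] : Set K) := by
      ext y
      constructor
      · rintro ⟨z, hz, rfl⟩
        simpa [hϖ0] using hz
      · intro hy
        exact ⟨_, hy, by simp [hϖ0]⟩
    rw [this]
    exact ((isOpen_integer K).preimage (by fun_prop)).measurableSet
  have hmem : ∀ z : 𝒪[K], (z : K) ∈ P ↔ IsLocalRing.residue 𝒪[K] z = 0 := by
    intro z
    rw [IsLocalRing.residue_eq_zero_iff, hϖ.maximalIdeal_eq, Ideal.mem_span_singleton]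
    constructor
    · rintro ⟨y, hy, h⟩
      exact ⟨⟨y, hy⟩, Subtype.ext h.symm⟩
    · rintro ⟨y, rfl⟩
      exact ⟨y, y.2, rfl⟩
  -- The q cosets of the maximal ideal P partition 𝒪, so translation invariance gives 1 = q · μ(P).
  have hU : (𝒪[K] : Set K) = ⋃ a : 𝓀[K], (fun z => -(r a : K) + z) ⁻¹' P := by
    ext z
    simp only [Set.mem_iUnion, Set.mem_preimage]
    constructor
    · intro hz
      refine ⟨IsLocalRing.residue 𝒪[K] ⟨z, hz⟩, ?_⟩
      refine (hmem (-r _ + ⟨z, hz⟩)).2 ?_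
      rw [map_add, map_neg, hr, neg_add_cancel]
    · rintro ⟨a, y, hy, h⟩
      have : z = r a + ϖ * y := by
        have h' : (ϖ : K) * y = -(r a : K) + z := h
        rw [h']; ring
      rw [this]
      exact add_mem (r a).2 (mul_mem ϖ.2 hy)
  have hdis : Pairwise (Function.onFun Disjoint
      fun a : 𝓀[K] => (fun z => -(r a : K) + z) ⁻¹' P) := by
    intro a b hab
    refine Set.disjoint_left.2 fun z hza hzb => hab ?_
    have hz : z ∈ (𝒪[K] : Set K) := by rw [hU]; exact Set.mem_iUnion.2 ⟨a, hza⟩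
    lift z to 𝒪[K] using hz
    have ha := (hmem (-r a + z)).1 hza
    have hb := (hmem (-r b + z)).1 hzb
    rw [map_add, map_neg, hr] at ha hb
    exact neg_injective (add_right_cancel (ha.trans hb.symm))
  have hm : haar K (𝒪[K] : Set K) = residueCard K * haar K P := by
    conv_lhs => rw [hU]
    have := Fintype.ofFinite 𝓀[K]
    rw [measure_iUnion hdis fun a => (measurable_const_add _) hP, tsum_fintype]
    simp [measure_preimage_add, residueCard, Nat.card_eq_fintype_card]
  rw [haar_integer] at hm
  have : absVal (ϖ : K) = (haar K P).toReal := absVal_eq _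
  rw [this]
  have h2 := congrArg ENNReal.toReal hm
  rw [ENNReal.toReal_mul, ENNReal.toReal_one, ENNReal.toReal_natCast] at h2
  exact eq_inv_of_mul_eq_one_right h2.symm

theorem absVal_lt_one_of_not_isUnit {z : 𝒪[K]} (hz : ¬ IsUnit z) : absVal (z : K) < 1 := by
  obtain ⟨ϖ, hϖ⟩ := IsDiscreteValuationRing.exists_irreducible 𝒪[K]
  have h : z ∈ IsLocalRing.maximalIdeal 𝒪[K] := (IsLocalRing.mem_maximalIdeal z).2 hz
  rw [hϖ.maximalIdeal_eq, Ideal.mem_span_singleton] at h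
  obtain ⟨y, rfl⟩ := h
  have h1 : (((ϖ * y : 𝒪[K])) : K) = ϖ * y := rfl
  have hq : (1 : ℝ) < residueCard K := by exact_mod_cast one_lt_residueCard K
  rw [h1, absVal_mul, absVal_irreducible hϖ]
  calc (residueCard K : ℝ)⁻¹ * absVal (y : K) ≤ (residueCard K : ℝ)⁻¹ * 1 := by
        gcongr
        exact absVal_le_one_of_mem y.2
    _ < 1 := by
        rw [mul_one]
        exact inv_lt_one_of_one_lt₀ hq

/-- If x is not integral, x⁻¹ is an integral nonunit, so |x⁻¹| < 1. This ties the Haar-defined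
absolute value to the valuation ring; the ultrametric inequality then reduces to 𝒪 being closed
under addition. -/
theorem absVal_le_one_iff {x : K} : absVal x ≤ 1 ↔ x ∈ 𝒪[K] := by
  refine ⟨fun h => by_contra fun hx => ?_, absVal_le_one_of_mem⟩
  have hx0 : x ≠ 0 := by rintro rfl; exact hx (zero_mem _)
  have hx' : 1 < ValuativeRel.valuation K x := not_le.1 hx
  have hi : ValuativeRel.valuation K x⁻¹ < 1 := by
    rw [map_inv₀]
    exact inv_lt_one_of_one_lt₀ hx'
  have hnu : ¬ IsUnit (⟨x⁻¹, hi.le⟩ : 𝒪[K]) := by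
    intro hu
    have h2 := absVal_eq_one_of_isUnit hu
    obtain ⟨y, hy⟩ := hu.exists_right_inv
    have h3 : x⁻¹ * (y : K) = 1 := congrArg Subtype.val hy
    have h4 : x = y := by
      field_simp at h3
      exact h3.symm
    exact hx (h4 ▸ y.2)
  have h2 := absVal_lt_one_of_not_isUnit hnu
  change absVal x⁻¹ < 1 at h2
  rw [absVal_inv] at h2
  have := (inv_lt_one₀ (absVal_pos hx0)).1 h2
  linarith

theorem absVal_add_le_max (x y : K) : absVal (x + y) ≤ max (absVal x) (absVal y) := by
  wlog h : absVal x ≤ absVal y generalizing x y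
  · rw [add_comm, max_comm]
    exact this y x (le_of_not_ge h)
  rw [max_eq_right h]
  rcases eq_or_ne y 0 with rfl | hy
  · rw [absVal_zero] at h
    rw [absVal_eq_zero.1 (le_antisymm h (absVal_nonneg x))]
    simp
  have h1 : x / y ∈ 𝒪[K] := by
    rw [← absVal_le_one_iff, div_eq_mul_inv, absVal_mul, absVal_inv, ← div_eq_mul_inv]
    exact div_le_one_of_le₀ h (absVal_nonneg y)
  have h2 := absVal_le_one_of_mem (add_mem h1 (one_mem 𝒪[K]))
  have h3 : x + y = (x / y + 1) * y := by field_simp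
  rw [h3, absVal_mul]
  exact mul_le_of_le_one_left (absVal_nonneg y) h2

theorem absVal_sub_le_max (x y : K) : absVal (x - y) ≤ max (absVal x) (absVal y) := by
  rw [sub_eq_add_neg, ← absVal_neg y]
  exact absVal_add_le_max x (-y)

variable (K) in
theorem exists_absVal_eq_zpow (m : ℤ) : ∃ x : K, x ≠ 0 ∧ absVal x = (residueCard K : ℝ) ^ m := by
  obtain ⟨ϖ, hϖ⟩ := IsDiscreteValuationRing.exists_irreducible 𝒪[K]
  have hϖ0 : (ϖ : K) ≠ 0 := by simpa using hϖ.ne_zero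
  exact ⟨(ϖ : K) ^ (-m), zpow_ne_zero _ hϖ0, by
    rw [absVal_zpow, absVal_irreducible hϖ, inv_zpow', neg_neg]⟩

theorem exists_zpow_eq_absVal {x : K} (hx : x ≠ 0) :
    ∃ m : ℤ, absVal x = (residueCard K : ℝ) ^ m := by
  obtain ⟨ϖ, hϖ⟩ := IsDiscreteValuationRing.exists_irreducible 𝒪[K]
  have key : ∀ z : 𝒪[K], z ≠ 0 → ∃ m : ℤ, absVal (z : K) = (residueCard K : ℝ) ^ m := by
    intro z hz
    obtain ⟨n, u, rfl⟩ := IsDiscreteValuationRing.eq_unit_mul_pow_irreducible hz hϖ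
    refine ⟨-n, ?_⟩
    have : (((u : 𝒪[K]) * ϖ ^ n : 𝒪[K]) : K) = (u : 𝒪[K]) * (ϖ : K) ^ n := rfl
    rw [this, absVal_mul, absVal_eq_one_of_isUnit u.isUnit, absVal_pow, absVal_irreducible hϖ]
    simp
  by_cases h : x ∈ 𝒪[K]
  · exact key ⟨x, h⟩ (by simpa [Subtype.ext_iff] using hx)
  · have h1 : x⁻¹ ∈ 𝒪[K] := by
      rw [← absVal_le_one_iff, absVal_inv]
      rw [← absVal_le_one_iff, not_le] at h
      exact inv_le_one_of_one_le₀ h.le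
    obtain ⟨m, hm⟩ := key ⟨x⁻¹, h1⟩ (by simpa [Subtype.ext_iff] using hx)
    refine ⟨-m, ?_⟩
    rw [zpow_neg, ← hm, absVal_inv, inv_inv]

theorem setOf_absVal_le {y : K} (hy : y ≠ 0) :
    {x : K | absVal x ≤ absVal y} = (fun z => y * z) '' (𝒪[K] : Set K) := by
  ext x
  constructor
  · intro hx
    refine ⟨y⁻¹ * x, ?_, by simp [hy]⟩
    change y⁻¹ * x ∈ 𝒪[K]
    rw [← absVal_le_one_iff, absVal_mul, absVal_inv, inv_mul_eq_div]
    exact div_le_one_of_le₀ hx (absVal_nonneg y)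
  · rintro ⟨z, hz, rfl⟩
    change absVal (y * z) ≤ absVal y
    rw [absVal_mul]
    exact mul_le_of_le_one_right (absVal_nonneg y) (absVal_le_one_of_mem hz)

theorem haar_absVal_le {y : K} (hy : y ≠ 0) :
    haar K {x : K | absVal x ≤ absVal y} = ENNReal.ofReal (absVal y) := by
  rw [setOf_absVal_le hy, absVal_eq, ENNReal.ofReal_toReal]
  exact ((isCompact_integer K).image (by fun_prop)).measure_lt_top.ne

theorem isOpen_absVal_le {y : K} (hy : y ≠ 0) : IsOpen {x : K | absVal x ≤ absVal y} := by
  rw [setOf_absVal_le hy]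
  exact (Homeomorph.mulLeft₀ y hy).isOpenMap _ (isOpen_integer K)

/-- The absolute value is locally constant off the origin. -/
theorem isOpen_absVal_eq (y : K) (hy : y ≠ 0) : IsOpen {x : K | absVal x = absVal y} := by
  obtain ⟨m, hm⟩ := exists_zpow_eq_absVal hy
  -- A perturbation smaller than |y| cannot change the absolute value, so the ball of the next
  -- smaller radius q^(m-1) serves as neighbourhood.
  obtain ⟨z, hz0, hz⟩ := exists_absVal_eq_zpow K (m - 1)
  have hq : (1 : ℝ) < residueCard K := by exact_mod_cast one_lt_residueCard K
  have hzy : absVal z < absVal y := by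
    rw [hz, hm]
    exact zpow_lt_zpow_right₀ hq (by lia)
  rw [isOpen_iff_mem_nhds]
  intro x hx
  have h1 : IsOpen ((fun w => w - x) ⁻¹' {w : K | absVal w ≤ absVal z}) :=
    (isOpen_absVal_le hz0).preimage (by fun_prop)
  refine Filter.mem_of_superset (h1.mem_nhds (by simp [absVal_zero, absVal_nonneg])) ?_
  intro w hw
  have hw' : absVal (w - x) < absVal y := lt_of_le_of_lt hw hzy
  have hx' : absVal x = absVal y := hx
  have e1 := absVal_add_le_max (w - x) x
  have e2 := absVal_sub_le_max w (w - x)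
  rw [sub_add_cancel] at e1
  rw [sub_sub_cancel] at e2
  refine le_antisymm (e1.trans (max_le hw'.le hx'.le)) ?_
  rcases le_max_iff.1 e2 with h | h
  · exact hx' ▸ h
  · linarith

variable (K) in
theorem range_absVal_countable : (Set.range (absVal : K → ℝ)).Countable := by
  refine ((Set.countable_range fun m : ℤ => (residueCard K : ℝ) ^ m).insert 0).mono ?_
  rintro _ ⟨x, rfl⟩
  rcases eq_or_ne x 0 with rfl | hx
  · exact Or.inl absVal_zero
  · obtain ⟨m, hm⟩ := exists_zpow_eq_absVal hx
    exact Or.inr ⟨m, hm.symm⟩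

-- Off the origin each superlevel set is a union of open spheres; the origin is a single point and
-- is treated apart.
variable (K) in
theorem measurable_absVal : Measurable (absVal : K → ℝ) := by
  refine measurable_of_Ioi fun t => ?_
  have := t2Space K
  have : absVal ⁻¹' Set.Ioi t \ {0} = ⋃ y ∈ {y : K | y ≠ 0 ∧ t < absVal y},
      {x : K | absVal x = absVal y} := by
    ext x
    simp only [Set.mem_sdiff, Set.mem_preimage, Set.mem_Ioi, Set.mem_singleton_iff, Set.mem_iUnion]
    constructor
    · rintro ⟨h1, h2⟩
      exact ⟨x, ⟨h2, h1⟩, rfl⟩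
    · rintro ⟨y, ⟨h1, h2⟩, h : absVal x = absVal y⟩
      refine ⟨h ▸ h2, ?_⟩
      rintro rfl
      rw [absVal_zero] at h
      exact (absVal_pos h1).ne h
  have hm : MeasurableSet (absVal ⁻¹' Set.Ioi t \ {(0 : K)}) := by
    rw [this]
    exact (isOpen_biUnion fun y hy => isOpen_absVal_eq y hy.1).measurableSet
  by_cases h0 : (0 : K) ∈ absVal ⁻¹' Set.Ioi t
  · rw [← Set.insert_sdiff_self_of_mem h0]
    exact hm.insert 0
  · rwa [Set.sdiff_singleton_eq_self h0] at hm

/-- Representatives of the residue classes are at mutual distance one. -/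
theorem exists_absVal_sub_eq_one {N : ℕ} (hq : N ≤ residueCard K) :
    ∃ x : Fin N → K, (∀ i, absVal (x i) ≤ 1) ∧ ∀ i j, i ≠ j → absVal (x i - x j) = 1 := by
  let r : 𝓀[K] → 𝒪[K] := Function.surjInv IsLocalRing.residue_surjective
  have hr : ∀ a, IsLocalRing.residue 𝒪[K] (r a) = a :=
    Function.surjInv_eq IsLocalRing.residue_surjective
  let e : Fin N ↪ 𝓀[K] := (Fin.castLEEmb hq).trans (Finite.equivFin 𝓀[K]).symm.toEmbedding
  refine ⟨fun i => r (e i), fun i => absVal_le_one_of_mem (r (e i)).2, fun i j hij => ?_⟩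
  refine absVal_eq_one_of_isUnit (u := r (e i) - r (e j)) ?_
  rw [← IsLocalRing.residue_ne_zero_iff_isUnit, map_sub, hr, hr, sub_ne_zero]
  exact e.injective.ne hij

end AbsoluteValue

/-! ### Integrable powers of the absolute value, and shears of K^N. -/

section Integrability

variable {K : Type*} [Field K] [ValuativeRel K] [TopologicalSpace K]
  [IsNonarchimedeanLocalField K] [MeasurableSpace K] [BorelSpace K]

theorem haar_absVal_le_zpow (m : ℤ) :
    haar K {x : K | absVal x ≤ (residueCard K : ℝ) ^ m} =
      ENNReal.ofReal ((residueCard K : ℝ) ^ m) := by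
  obtain ⟨y, hy, h⟩ := exists_absVal_eq_zpow K m
  rw [← h, haar_absVal_le hy]

theorem measurableSet_absVal_le (t : ℝ) : MeasurableSet {x : K | absVal x ≤ t} :=
  measurableSet_le (measurable_absVal K) measurable_const

/-- Powers of the absolute value with exponent greater than `-1` are integrable on balls. -/
theorem integrable_absVal_rpow (m : ℤ) {γ : ℝ} (hγ : 0 < γ) :
    Integrable ({x : K | absVal x ≤ (residueCard K : ℝ) ^ m}.indicator
      fun x => absVal x ^ (γ - 1)) (haar K) := by
  set q : ℝ := (residueCard K : ℝ) with hqdef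
  have hq : (1 : ℝ) < q := Nat.one_lt_cast.2 (one_lt_residueCard K)
  have hq0 : 0 < q := by linarith
  refine ⟨(((measurable_absVal K).pow_const _).indicator
    (measurableSet_absVal_le _)).aestronglyMeasurable, ?_⟩
  -- On the shell |x| = q^(m-n) the nth summand alone equals the function. Using whole balls instead
  -- of shells avoids computing shell volumes and still gives a geometric series of ratio q^(-γ).
  have hpt : ∀ᵐ x ∂(haar K), ‖({x : K | absVal x ≤ q ^ m}.indicator
      fun x => absVal x ^ (γ - 1)) x‖ₑ ≤
      ∑' n : ℕ, {x : K | absVal x ≤ q ^ (m - n)}.indicator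
        (fun _ => ENNReal.ofReal ((q ^ (m - n)) ^ (γ - 1))) x := by
    have h0 : ∀ᵐ x ∂(haar K), x ≠ 0 := by
      rw [ae_iff]
      simp
    filter_upwards [h0] with x hx
    by_cases hxm : absVal x ≤ q ^ m
    · obtain ⟨l, hl⟩ := exists_zpow_eq_absVal hx
      rw [← hqdef] at hl
      have hlm : l ≤ m := (zpow_le_zpow_iff_right₀ hq).1 (hl ▸ hxm)
      obtain ⟨n, hn⟩ := Int.eq_ofNat_of_zero_le (sub_nonneg.2 hlm)
      have hln : l = m - n := by lia
      refine le_trans (le_of_eq ?_) (ENNReal.le_tsum n)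
      rw [Set.indicator_of_mem (show x ∈ {x : K | absVal x ≤ q ^ m} from hxm),
        Set.indicator_of_mem (show x ∈ {x : K | absVal x ≤ q ^ (m - n)} from (hln ▸ hl).le),
        Real.enorm_eq_ofReal (Real.rpow_nonneg (absVal_nonneg x) _), hl, hln]
    · rw [Set.indicator_of_notMem (show x ∉ {x : K | absVal x ≤ q ^ m} from hxm)]
      simp
  refine lt_of_le_of_lt (lintegral_mono_ae hpt) ?_
  rw [lintegral_tsum fun n =>
    (measurable_const.indicator (measurableSet_absVal_le _)).aemeasurable]
  have hterm : ∀ n : ℕ, ∫⁻ x, {x : K | absVal x ≤ q ^ (m - n)}.indicator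
      (fun _ => ENNReal.ofReal ((q ^ (m - n)) ^ (γ - 1))) x ∂(haar K) =
      ENNReal.ofReal ((q ^ m) ^ γ * (q ^ (-γ)) ^ n) := by
    intro n
    have hp : (0 : ℝ) < q ^ (m - n) := zpow_pos hq0 _
    rw [lintegral_indicator_const (measurableSet_absVal_le _), haar_absVal_le_zpow,
      ← ENNReal.ofReal_mul (Real.rpow_nonneg hp.le _)]
    congr 1
    rw [← hqdef, ← Real.rpow_add_one hp.ne', sub_add_cancel, zpow_sub₀ hq0.ne', zpow_natCast,
      Real.div_rpow (zpow_pos hq0 m).le (by positivity), ← Real.rpow_natCast (q ^ (-γ)),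
      ← Real.rpow_natCast q, ← Real.rpow_mul hq0.le, ← Real.rpow_mul hq0.le, div_eq_mul_inv,
      ← Real.rpow_neg hq0.le]
    congr 2
    ring
  simp_rw [hterm]
  have hs : Summable fun n : ℕ => (q ^ m) ^ γ * (q ^ (-γ)) ^ n :=
    (summable_geometric_of_lt_one (by positivity)
      (Real.rpow_lt_one_of_one_lt_of_neg hq (by linarith))).mul_left _
  rw [← ENNReal.ofReal_tsum_of_nonneg (fun n => by positivity) hs]
  exact ENNReal.ofReal_lt_top

variable {N : ℕ}

/-- Subtract the `j`-th coordinate from all other ones. -/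
def shear (j : Fin N) (x : Fin N → K) : Fin N → K := fun k => if k = j then x j else x k - x j

variable (K) in
/-- The shear as an automorphism of the topological group `K^N`. -/
def shearEquiv (j : Fin N) : (Fin N → K) ≃ₜ+ (Fin N → K) where
  toFun := shear j
  invFun y := fun k => if k = j then y j else y k + y j
  left_inv x := by
    ext k
    by_cases h : k = j <;> simp [shear, h]
  right_inv x := by
    ext k
    by_cases h : k = j <;> simp [shear, h]
  map_add' x y := by
    ext k
    by_cases h : k = j
    · simp [shear, h]
    · simp [shear, h]; ring
  continuous_toFun := by
    refine continuous_pi fun k => ?_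
    by_cases h : k = j
    · simpa [shear, h] using continuous_apply j
    · simp only [shear, h, if_false]
      fun_prop
  continuous_invFun := by
    refine continuous_pi fun k => ?_
    by_cases h : k = j
    · simpa [h] using continuous_apply j
    · simp only [h, if_false]
      fun_prop

/-- A topological group automorphism carries Haar measure to a Haar measure, hence to a multiple of
it; the factor is irrelevant to integrability. -/
theorem integrable_comp_shear (j : Fin N) {g : (Fin N → K) → ℝ}
    (hg : Integrable g (Measure.pi fun _ => haar K)) :
    Integrable (fun x => g (shear j x)) (Measure.pi fun _ => haar K) := by
  have := secondCountableTopology K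
  have := t2Space K
  let μ : Measure (Fin N → K) := Measure.pi fun _ => haar K
  let φ := shearEquiv K j
  have hmap : (μ.map φ).IsAddHaarMeasure := φ.isAddHaarMeasure_map μ
  have h := Measure.isAddLeftInvariant_eq_smul (μ.map φ) μ
  have hint : Integrable g (μ.map φ) := by
    rw [h]
    exact hg.smul_measure_nnreal
  exact (integrable_map_equiv φ.toHomeomorph.toMeasurableEquiv g).1 hint

/-- This is the integrable majorant. The sum over j is there because the particle from which
differences are taken depends on x. -/
theorem integrable_sum_prod_shear (m : ℤ) {γ : ℝ} (hγ : 0 < γ) :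
    Integrable (fun x : Fin N → K => ∑ j, ∏ k,
      ({x : K | absVal x ≤ (residueCard K : ℝ) ^ m}.indicator
        fun x => (absVal x / (residueCard K : ℝ) ^ m) ^ (γ - 1)) (shear j x k))
      (Measure.pi fun _ => haar K) := by
  have hB : (0 : ℝ) < (residueCard K : ℝ) ^ m :=
    zpow_pos (by exact_mod_cast (one_lt_residueCard K).le) m
  have h1 : Integrable ({x : K | absVal x ≤ (residueCard K : ℝ) ^ m}.indicator
        fun x => (absVal x / (residueCard K : ℝ) ^ m) ^ (γ - 1)) (haar K) := by
    convert (integrable_absVal_rpow (K := K) m hγ).div_const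
      (((residueCard K : ℝ) ^ m) ^ (γ - 1)) using 1
    ext x
    by_cases hx : absVal x ≤ (residueCard K : ℝ) ^ m
    · simp [Set.indicator, hx, Real.div_rpow (absVal_nonneg x) hB.le]
    · simp [Set.indicator, hx]
  refine integrable_finsetSum _ fun j _ => integrable_comp_shear j
    (g := fun y => ∏ k, ({x : K | absVal x ≤ (residueCard K : ℝ) ^ m}.indicator
        fun x => (absVal x / (residueCard K : ℝ) ^ m) ^ (γ - 1)) (y k)) ?_
  exact Integrable.fintype_prod (fun _ => h1)

theorem ae_coord_ne_zero : ∀ᵐ x : Fin N → K ∂(Measure.pi fun _ => haar K), ∀ i, x i ≠ 0 := by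
  rw [ae_all_iff]
  intro i
  rw [ae_iff]
  simpa using Measure.pi_hyperplane (fun _ : Fin N => haar K) i 0

end Integrability

/-! ### Power bounds for ρ. -/

section Growth

/-- The growth condition at zero, as a polynomial bound. -/
theorem MildGrowth.eventually_le {ρ : ℝ → ℝ} (h : MildGrowth ρ) {ε : ℝ} (hε : 0 < ε) :
    ∀ᶠ n : ℕ in atTop, |ρ (1 / (n : ℝ))| ≤ (n : ℝ) ^ (1 + ε) := by
  have h1 : ((1 : ℝ) : EReal) < ((1 + ε : ℝ) : EReal) := by
    exact_mod_cast (lt_add_iff_pos_right 1).2 hε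
  have h2 := eventually_lt_of_limsup_lt (lt_of_le_of_lt h.1 h1)
  filter_upwards [h2, eventually_ge_atTop 2] with n hn hn2
  have hn1 : (1 : ℝ) < n := by exact_mod_cast hn2
  have hl : 0 < Real.log n := Real.log_pos hn1
  rw [EReal.div_lt_iff (by exact_mod_cast hl) (EReal.coe_ne_top _)] at hn
  have h3 : ((1 + ε : ℝ) : EReal) * (Real.log n : EReal) =
      ENNReal.log (ENNReal.ofReal ((n : ℝ) ^ (1 + ε))) := by
    rw [ENNReal.log_ofReal_of_pos (by positivity), Real.log_rpow (by linarith), EReal.coe_mul]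
  rw [h3, ENNReal.log_lt_log_iff] at hn
  exact ((ENNReal.ofReal_lt_ofReal_iff (by positivity)).1 hn).le

/-- For m < -n₀ the growth condition applies at the integer q^(-m) ≥ n₀; the finitely many remaining
m ≤ M are absorbed into C through the sum of their values of g. -/
theorem MildGrowth.exists_bound {ρ : ℝ → ℝ} (h : MildGrowth ρ) {q : ℕ} (hq : 1 < q) (M : ℤ)
    {ε : ℝ} (hε : 0 < ε) :
    ∃ C : ℝ, 0 ≤ C ∧ ∀ m : ℤ, m ≤ M →
      |ρ ((q : ℝ) ^ m)| ≤ C * ((q : ℝ) ^ m / (q : ℝ) ^ M) ^ (-1 - ε) := by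
  have hq0 : (0 : ℝ) < q := by positivity
  obtain ⟨n₀, hn₀⟩ := eventually_atTop.1 (h.eventually_le hε)
  let g : ℤ → ℝ := fun m => |ρ ((q : ℝ) ^ m)| * ((q : ℝ) ^ m / (q : ℝ) ^ M) ^ (1 + ε)
  have hg : ∀ m, 0 ≤ g m := fun m => by positivity
  have hinv : ∀ m : ℤ, ((q : ℝ) ^ m / (q : ℝ) ^ M) ^ (1 + ε) *
      ((q : ℝ) ^ m / (q : ℝ) ^ M) ^ (-1 - ε) = 1 := by
    intro m
    rw [← Real.rpow_add (by positivity)]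
    ring_nf
    simp
  have hsuff : ∀ (C : ℝ) (m : ℤ), g m ≤ C →
      |ρ ((q : ℝ) ^ m)| ≤ C * ((q : ℝ) ^ m / (q : ℝ) ^ M) ^ (-1 - ε) := by
    intro C m hC
    calc |ρ ((q : ℝ) ^ m)| = g m * ((q : ℝ) ^ m / (q : ℝ) ^ M) ^ (-1 - ε) := by
          rw [mul_assoc, hinv, mul_one]
      _ ≤ _ := by gcongr
  refine ⟨((q : ℝ) ^ M) ^ (-(1 + ε)) + ∑ m ∈ Finset.Icc (-(n₀ : ℤ)) M, g m,
    add_nonneg (by positivity) (Finset.sum_nonneg fun m _ => hg m),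
    fun m hm => hsuff _ m ?_⟩
  rcases lt_or_ge m (-(n₀ : ℤ)) with hlt | hge
  · refine le_add_of_le_of_nonneg ?_ (Finset.sum_nonneg fun m _ => hg m)
    obtain ⟨k, hk⟩ := Int.eq_ofNat_of_zero_le (show 0 ≤ -m by lia)
    have hmk : m = -(k : ℤ) := by lia
    have hkn : n₀ ≤ q ^ k := le_trans (by lia) (Nat.lt_pow_self hq).le
    have hb := hn₀ _ hkn
    have he : (1 : ℝ) / ((q ^ k : ℕ) : ℝ) = (q : ℝ) ^ m := by
      rw [hmk, zpow_neg]
      simp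
    have he' : ((q ^ k : ℕ) : ℝ) = ((q : ℝ) ^ m)⁻¹ := by
      rw [← he]
      simp
    rw [he, he'] at hb
    have hpm : (0 : ℝ) < (q : ℝ) ^ m := by positivity
    calc g m ≤ ((q : ℝ) ^ m)⁻¹ ^ (1 + ε) * ((q : ℝ) ^ m / (q : ℝ) ^ M) ^ (1 + ε) := by
          exact mul_le_mul_of_nonneg_right hb (by positivity)
      _ = ((q : ℝ) ^ M) ^ (-(1 + ε)) := by
          rw [← Real.mul_rpow (by positivity) (by positivity), Real.rpow_neg (by positivity),
            ← Real.inv_rpow (by positivity)]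
          congr 1
          field_simp
  · refine le_add_of_nonneg_of_le (by positivity) ?_
    exact Finset.single_le_sum (f := g) (fun m _ => hg m) (Finset.mem_Icc.2 ⟨hge, hm⟩)

end Growth

/-! ### Norm, diameter and minimum distance. -/

section Distances

variable {K : Type*} [Field K] [ValuativeRel K] [TopologicalSpace K]
  [IsNonarchimedeanLocalField K] [MeasurableSpace K] [BorelSpace K] {N : ℕ}

theorem absVal_le_stdNorm (x : Fin N → K) (i : Fin N) : absVal (x i) ≤ stdNorm x :=
  le_ciSup (f := fun i => absVal (x i)) (Set.finite_range _).bddAbove i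

theorem exists_stdNorm_eq [Nonempty (Fin N)] (x : Fin N → K) :
    ∃ i, absVal (x i) = stdNorm x :=
  exists_eq_ciSup_of_finite (f := fun i => absVal (x i))

theorem nonempty_pairs (hN : 2 ≤ N) : Nonempty {p : Fin N × Fin N // p.1 < p.2} :=
  ⟨⟨(⟨0, by lia⟩, ⟨1, by lia⟩), by simp⟩⟩

theorem absVal_sub_le_maxDist (x : Fin N → K) {i j : Fin N} (hij : i ≠ j) :
    absVal (x i - x j) ≤ maxDist x := by
  have key : ∀ p : {p : Fin N × Fin N // p.1 < p.2}, absVal (x p.1.1 - x p.1.2) ≤ maxDist x :=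
    fun p => le_ciSup (f := fun p : {p : Fin N × Fin N // p.1 < p.2} =>
      absVal (x p.1.1 - x p.1.2)) (Set.finite_range _).bddAbove p
  rcases lt_or_gt_of_ne hij with h | h
  · exact key ⟨(i, j), h⟩
  · rw [absVal_sub_comm]
    exact key ⟨(j, i), h⟩

theorem exists_minDist_eq (hN : 2 ≤ N) (x : Fin N → K) :
    ∃ i j, i < j ∧ absVal (x i - x j) = minDist x := by
  have := nonempty_pairs hN
  obtain ⟨p, hp⟩ := exists_eq_ciInf_of_finite
    (f := fun p : {p : Fin N × Fin N // p.1 < p.2} => absVal (x p.1.1 - x p.1.2))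
  exact ⟨p.1.1, p.1.2, p.2, hp⟩

theorem absVal_sub_le_stdNorm (x : Fin N → K) (i j : Fin N) :
    absVal (x i - x j) ≤ stdNorm x :=
  (absVal_sub_le_max _ _).trans (max_le (absVal_le_stdNorm x i) (absVal_le_stdNorm x j))

theorem maxDist_le_stdNorm (hN : 2 ≤ N) (x : Fin N → K) : maxDist x ≤ stdNorm x := by
  have := nonempty_pairs hN
  exact ciSup_le fun p => absVal_sub_le_stdNorm x _ _

theorem minDist_le_maxDist (hN : 2 ≤ N) (x : Fin N → K) : minDist x ≤ maxDist x := by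
  obtain ⟨i, j, hij, h⟩ := exists_minDist_eq hN x
  rw [← h]
  exact absVal_sub_le_maxDist x hij.ne

theorem measurable_coord_absVal (i : Fin N) : Measurable fun x : Fin N → K => absVal (x i) :=
  (measurable_absVal K).comp (measurable_pi_apply i)

theorem measurable_coord_absVal_sub (i j : Fin N) :
    Measurable fun x : Fin N → K => absVal (x i - x j) := by
  have := secondCountableTopology K
  exact (measurable_absVal K).comp ((measurable_pi_apply i).sub (measurable_pi_apply j))

theorem measurable_stdNorm : Measurable (stdNorm : (Fin N → K) → ℝ) :=
  Measurable.iSup fun i => measurable_coord_absVal i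

theorem measurable_maxDist : Measurable (maxDist : (Fin N → K) → ℝ) :=
  Measurable.iSup fun _ => measurable_coord_absVal_sub _ _

theorem measurable_minDist : Measurable (minDist : (Fin N → K) → ℝ) :=
  Measurable.iInf fun _ => measurable_coord_absVal_sub _ _

/-- No regularity of ρ is needed: the norm has countable range, and every function on a countable
set of reals is measurable. -/
theorem measurable_comp_stdNorm [Nonempty (Fin N)] (ρ : ℝ → ℝ) :
    Measurable fun x : Fin N → K => ρ (stdNorm x) := by
  have hcount : (Set.range (stdNorm : (Fin N → K) → ℝ)).Countable := by
    refine (range_absVal_countable K).mono ?_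
    rintro _ ⟨x, rfl⟩
    obtain ⟨i, hi⟩ := exists_stdNorm_eq x
    exact ⟨x i, hi⟩
  have := hcount.to_subtype
  have hm : Measurable (Set.rangeFactorization (stdNorm : (Fin N → K) → ℝ)) :=
    measurable_stdNorm.subtype_mk
  exact (measurable_of_countable fun t : Set.range (stdNorm : (Fin N → K) → ℝ) => ρ t).comp hm

theorem stdNorm_mem_normValues [Nonempty (Fin N)] (x : Fin N → K) :
    stdNorm x ∈ normValues := by
  obtain ⟨i, hi⟩ := exists_stdNorm_eq x
  rw [← hi]
  rcases eq_or_ne (x i) 0 with h | h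
  · rw [h, absVal_zero]
    exact Or.inl rfl
  · obtain ⟨m, hm⟩ := exists_zpow_eq_absVal h
    rw [hm]
    have hq := one_lt_residueCard K
    obtain ⟨n, h' | h'⟩ := m.eq_nat_or_neg
    all_goals
      refine Or.inr (Set.mem_iUnion₂.2 ⟨residueCard K ^ n, Nat.one_le_pow _ _ (by lia), ?_⟩)
      simp [h']

theorem exists_stdNorm_eq_zpow [Nonempty (Fin N)] {x : Fin N → K} (hx : ∀ i, x i ≠ 0) :
    ∃ m : ℤ, stdNorm x = (residueCard K : ℝ) ^ m := by
  obtain ⟨i, hi⟩ := exists_stdNorm_eq x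
  rw [← hi]
  exact exists_zpow_eq_absVal (hx i)

end Distances

/-! ### The weight normalized at the scale B. -/

section Weight

variable {K : Type*} [Field K] [ValuativeRel K] [TopologicalSpace K]
  [IsNonarchimedeanLocalField K] [MeasurableSpace K] [BorelSpace K] {N : ℕ}

/-- The product `∏_{i<j} (|x_i - x_j| / B)^(q_i q_j)`. -/
noncomputable def scaledProd (B : ℝ) (c : Fin N → ℝ) (x : Fin N → K) : ℝ :=
  ∏ i, ∏ j ∈ Finset.Ioi i, (absVal (x i - x j) / B) ^ (c i * c j)

theorem scaledProd_nonneg {B : ℝ} (hB : 0 < B) (c : Fin N → ℝ) (x : Fin N → K) :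
    0 ≤ scaledProd B c x :=
  Finset.prod_nonneg fun _ _ => Finset.prod_nonneg fun _ _ =>
    Real.rpow_nonneg (div_nonneg (absVal_nonneg _) hB.le) _

theorem measurable_scaledProd (B : ℝ) (c : Fin N → ℝ) :
    Measurable (scaledProd B c : (Fin N → K) → ℝ) :=
  Finset.measurable_fun_prod _ fun i _ => Finset.measurable_fun_prod _ fun j _ =>
    ((measurable_coord_absVal_sub i j).div_const B).pow_const _

/-- The β-dependence splits into a factor constant in x, which cancels in expectations, and a power
of a base that lies in [0, 1] when all distances are at most B. -/
theorem weight_eq {B : ℝ} (hB : 0 < B) (ρ : ℝ → ℝ) (c : Fin N → ℝ) (β : ℝ) (x : Fin N → K) :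
    weight ρ c β x = (∏ i, ∏ j ∈ Finset.Ioi i, B ^ (c i * c j)) ^ β *
      (ρ (stdNorm x) * scaledProd B c x ^ β) := by
  have h : ∏ i, ∏ j ∈ Finset.Ioi i, absVal (x i - x j) ^ (c i * c j * β) =
      (∏ i, ∏ j ∈ Finset.Ioi i, B ^ (c i * c j)) ^ β * scaledProd B c x ^ β := by
    rw [← Real.mul_rpow (Finset.prod_nonneg fun _ _ => Finset.prod_nonneg fun _ _ =>
      Real.rpow_nonneg hB.le _) (scaledProd_nonneg hB c x), scaledProd,
      ← Finset.prod_mul_distrib]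
    simp_rw [← Finset.prod_mul_distrib]
    rw [← Real.finsetProd_rpow _ _ fun _ _ => Finset.prod_nonneg fun _ _ => mul_nonneg
      (Real.rpow_nonneg hB.le _) (Real.rpow_nonneg (div_nonneg (absVal_nonneg _) hB.le) _)]
    refine Finset.prod_congr rfl fun i _ => ?_
    rw [← Real.finsetProd_rpow _ _ fun _ _ => mul_nonneg
      (Real.rpow_nonneg hB.le _) (Real.rpow_nonneg (div_nonneg (absVal_nonneg _) hB.le) _)]
    refine Finset.prod_congr rfl fun j _ => ?_
    rw [← Real.mul_rpow hB.le (div_nonneg (absVal_nonneg _) hB.le), mul_div_cancel₀ _ hB.ne',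
      ← Real.rpow_mul (absVal_nonneg _)]
  rw [weight, h]
  ring

theorem prod_le_of_le_one {ι : Type*} {s : Finset ι} {f : ι → ℝ}
    (h0 : ∀ i ∈ s, 0 ≤ f i) (h1 : ∀ i ∈ s, f i ≤ 1) {p : ι} (hp : p ∈ s) :
    ∏ i ∈ s, f i ≤ f p := by
  classical
  rw [← Finset.mul_prod_erase s f hp]
  exact mul_le_of_le_one_right (h0 p hp) (Finset.prod_le_one
    (fun i hi => h0 i (Finset.mem_of_mem_erase hi)) fun i hi => h1 i (Finset.mem_of_mem_erase hi))

theorem scaledProd_le {B : ℝ} (hB : 0 < B) {c : Fin N → ℝ} (hc : ∀ i, 0 < c i) {x : Fin N → K}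
    (hx : ∀ i j, absVal (x i - x j) ≤ B) {i j : Fin N} (hij : i < j) :
    scaledProd B c x ≤ (absVal (x i - x j) / B) ^ (c i * c j) := by
  have h0 : ∀ i j, 0 ≤ (absVal (x i - x j) / B) ^ (c i * c j) := fun i j =>
    Real.rpow_nonneg (div_nonneg (absVal_nonneg _) hB.le) _
  have h1 : ∀ i j, (absVal (x i - x j) / B) ^ (c i * c j) ≤ 1 := fun i j =>
    Real.rpow_le_one (div_nonneg (absVal_nonneg _) hB.le) (div_le_one_of_le₀ (hx i j) hB.le)
      (mul_pos (hc i) (hc j)).le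
  refine (prod_le_of_le_one (p := i) (fun i _ => Finset.prod_nonneg fun j _ => h0 i j)
    (fun i _ => Finset.prod_le_one (fun j _ => h0 i j) fun j _ => h1 i j)
    (Finset.mem_univ i)).trans ?_
  exact prod_le_of_le_one (p := j) (fun j _ => h0 i j) (fun j _ => h1 i j)
    (Finset.mem_Ioi.2 hij)

theorem scaledProd_le_one {B : ℝ} (hB : 0 < B) {c : Fin N → ℝ} (hc : ∀ i, 0 < c i)
    {x : Fin N → K} (hx : ∀ i j, absVal (x i - x j) ≤ B) : scaledProd B c x ≤ 1 :=
  Finset.prod_le_one (fun _ _ => Finset.prod_nonneg fun _ _ =>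
    Real.rpow_nonneg (div_nonneg (absVal_nonneg _) hB.le) _) fun i _ => Finset.prod_le_one
    (fun _ _ => Real.rpow_nonneg (div_nonneg (absVal_nonneg _) hB.le) _) fun j _ =>
    Real.rpow_le_one (div_nonneg (absVal_nonneg _) hB.le) (div_le_one_of_le₀ (hx i j) hB.le)
      (mul_pos (hc i) (hc j)).le

theorem scaledProd_eq_one_iff {B : ℝ} (hB : 0 < B) {c : Fin N → ℝ} (hc : ∀ i, 0 < c i)
    {x : Fin N → K} (hx : ∀ i j, absVal (x i - x j) ≤ B) :
    scaledProd B c x = 1 ↔ ∀ i j, i ≠ j → absVal (x i - x j) = B := by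
  constructor
  · intro h
    have key : ∀ i j, i < j → absVal (x i - x j) = B := by
      intro i j hij
      refine le_antisymm (hx i j) (not_lt.1 fun hlt => ?_)
      have h1 := scaledProd_le hB hc hx hij
      rw [h] at h1
      have h2 := Real.rpow_lt_one (div_nonneg (absVal_nonneg (x i - x j)) hB.le)
        ((div_lt_one hB).2 hlt) (mul_pos (hc i) (hc j))
      linarith
    intro i j hij
    rcases lt_or_gt_of_ne hij with h' | h'
    · exact key i j h'
    · rw [absVal_sub_comm]
      exact key j i h'
  · intro h
    refine Finset.prod_eq_one fun i _ => Finset.prod_eq_one fun j hj => ?_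
    rw [h i j (Finset.mem_Ioi.1 hj).ne, div_self hB.ne', Real.one_rpow]

end Weight

/-! ### Real inequalities between the three scales. -/

section Bounds

/-- The exponents of s, d and τ must rise by 2γ, γ(N - 2) and γ. As τ ≤ d ≤ s, each rise can be paid
for with the same power of τ, for a total of γ(N + 1) ≤ δ. -/
theorem rpow_bound_of_scales {N : ℕ} (hN : 2 ≤ N) {s d τ γ δ : ℝ} (hτ : 0 < τ) (hτd : τ ≤ d)
    (hds : d ≤ s) (hs : s ≤ 1) (hγ : 0 < γ) (hδ : γ * (N + 1) ≤ δ) :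
    s ^ (-1 - γ) * (d ^ (2 - N : ℝ) * τ ^ (-1 : ℝ)) * τ ^ δ ≤
      s ^ (γ - 1) * (τ ^ (γ - 1) * (d ^ (γ - 1)) ^ (N - 2)) := by
  have hd : 0 < d := hτ.trans_le hτd
  have hs0 : 0 < s := hd.trans_le hds
  have hN' : (2 : ℝ) ≤ N := by exact_mod_cast hN
  have e1 : s ^ (-1 - γ) ≤ s ^ (γ - 1) * τ ^ (-2 * γ) := by
    calc s ^ (-1 - γ) = s ^ (γ - 1) * s ^ (-2 * γ) := by
          rw [← Real.rpow_add hs0]; ring_nf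
      _ ≤ _ := by
          have h : -2 * γ ≤ 0 := by linarith
          exact mul_le_mul_of_nonneg_left
            (Real.rpow_le_rpow_of_nonpos hτ (hτd.trans hds) h) (by positivity)
  have e2 : d ^ (2 - N : ℝ) ≤ (d ^ (γ - 1)) ^ (N - 2) * τ ^ (-γ * (N - 2)) := by
    calc d ^ (2 - N : ℝ) = d ^ ((γ - 1) * (N - (2 : ℕ))) * d ^ (-γ * (N - 2)) := by
          rw [← Real.rpow_add hd]
          push_cast
          ring_nf
      _ ≤ _ := by
          rw [← Real.rpow_natCast (d ^ (γ - 1)), ← Real.rpow_mul hd.le, Nat.cast_sub hN]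
          have h : -γ * (N - 2) ≤ 0 := by nlinarith
          exact mul_le_mul_of_nonneg_left
            (Real.rpow_le_rpow_of_nonpos hτ hτd h) (by positivity)
  calc s ^ (-1 - γ) * (d ^ (2 - N : ℝ) * τ ^ (-1 : ℝ)) * τ ^ δ
      ≤ (s ^ (γ - 1) * τ ^ (-2 * γ)) * (((d ^ (γ - 1)) ^ (N - 2) * τ ^ (-γ * (N - 2))) *
        τ ^ (-1 : ℝ)) * τ ^ δ := by gcongr
    _ = s ^ (γ - 1) * (d ^ (γ - 1)) ^ (N - 2) *
        (τ ^ (-2 * γ) * τ ^ (-γ * (N - 2)) * τ ^ (-1 : ℝ) * τ ^ δ) := by ring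
    _ = s ^ (γ - 1) * (d ^ (γ - 1)) ^ (N - 2) * (τ ^ (γ - 1) * τ ^ (δ - γ * (N + 1))) := by
        rw [← Real.rpow_add hτ, ← Real.rpow_add hτ, ← Real.rpow_add hτ, ← Real.rpow_add hτ]
        ring_nf
    _ ≤ s ^ (γ - 1) * (d ^ (γ - 1)) ^ (N - 2) * (τ ^ (γ - 1) * 1) := by
        gcongr
        exact Real.rpow_le_one hτ.le (hτd.trans (hds.trans hs)) (by linarith)
    _ = _ := by ring

/-- Since Re b + 1 ≥ 0, all of the power of t except t^(-1) can be moved onto D ≥ t; the resulting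
exponent of D/B ≤ 1 is at least 2 - N. -/
theorem norm_cpow_mul_cpow_le {N : ℕ} {a b : ℂ} (hb : -1 ≤ b.re)
    (hab : 1 - (N : ℝ) ≤ (a + b).re) {B D t : ℝ} (hB : 0 < B) (ht : 0 < t) (htD : t ≤ D)
    (hDB : D ≤ B) :
    ‖(D : ℂ) ^ a * (t : ℂ) ^ b‖ ≤
      B ^ (a.re + b.re) * ((D / B) ^ (2 - N : ℝ) * (t / B) ^ (-1 : ℝ)) := by
  have hD : 0 < D := ht.trans_le htD
  have hd : 0 < D / B := by positivity
  have hτ : 0 < t / B := by positivity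
  rw [norm_mul, Complex.norm_cpow_eq_rpow_re_of_pos hD, Complex.norm_cpow_eq_rpow_re_of_pos ht]
  have e1 : D ^ a.re * t ^ b.re = B ^ (a.re + b.re) * ((D / B) ^ a.re * (t / B) ^ b.re) := by
    rw [Real.div_rpow hD.le hB.le, Real.div_rpow ht.le hB.le, Real.rpow_add hB]
    field_simp
  rw [e1]
  gcongr ?_ * ?_
  calc (D / B) ^ a.re * (t / B) ^ b.re
      = (D / B) ^ a.re * ((t / B) ^ (b.re + 1) * (t / B) ^ (-1 : ℝ)) := by
        rw [← Real.rpow_add hτ]; ring_nf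
    _ ≤ (D / B) ^ a.re * ((D / B) ^ (b.re + 1) * (t / B) ^ (-1 : ℝ)) := by
        gcongr
        linarith
    _ = (D / B) ^ (a.re + b.re + 1) * (t / B) ^ (-1 : ℝ) := by
        rw [← mul_assoc, ← Real.rpow_add hd]; ring_nf
    _ ≤ (D / B) ^ (2 - N : ℝ) * (t / B) ^ (-1 : ℝ) := by
        gcongr ?_ * _
        refine Real.rpow_le_rpow_of_exponent_ge hd (div_le_one_of_le₀ hDB hB.le) ?_
        rw [Complex.add_re] at hab
        linarith

end Bounds

/-! ### Domination of the observable times the weight. -/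

section Domination

variable {K : Type*} [Field K] [ValuativeRel K] [TopologicalSpace K]
  [IsNonarchimedeanLocalField K] [MeasurableSpace K] [BorelSpace K] {N : ℕ}

/-- The exponent γ - 1 is nonpositive, so |x_j| ≤ ‖x‖ and |x_k - x_j| ≤ `maxDist x` bound the
factors in the reverse direction; the factor k = i is kept exactly. -/
theorem le_prod_shear {B : ℝ} (hB : 0 < B) {γ : ℝ} (hγ1 : γ ≤ 1) {x : Fin N → K}
    (hx : ∀ i, x i ≠ 0) (hxB : stdNorm x ≤ B) (hinj : ∀ i j, i ≠ j → x i ≠ x j) {i j : Fin N}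
    (hij : i ≠ j) :
    (stdNorm x / B) ^ (γ - 1) * ((absVal (x i - x j) / B) ^ (γ - 1) *
      ((maxDist x / B) ^ (γ - 1)) ^ (N - 2)) ≤
    ∏ k, ({x : K | absVal x ≤ B}.indicator fun x => (absVal x / B) ^ (γ - 1)) (shear j x k) := by
  have hmem : ∀ k, shear j x k ∈ {x : K | absVal x ≤ B} := by
    intro k
    by_cases h : k = j
    · simpa [shear, h] using (absVal_le_stdNorm x j).trans hxB
    · simpa [shear, h] using (absVal_sub_le_stdNorm x k j).trans hxB
  simp_rw [fun k => Set.indicator_of_mem (hmem k) fun x => (absVal x / B) ^ (γ - 1)]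
  have hle : ∀ {u v : ℝ}, 0 < u → u ≤ v → (v / B) ^ (γ - 1) ≤ (u / B) ^ (γ - 1) :=
    fun hu huv => Real.rpow_le_rpow_of_nonpos (by positivity) (by gcongr) (by linarith)
  have hnn : ∀ k, 0 ≤ (absVal (shear j x k) / B) ^ (γ - 1) := fun k =>
    Real.rpow_nonneg (div_nonneg (absVal_nonneg _) hB.le) _
  rw [← Finset.mul_prod_erase Finset.univ _ (Finset.mem_univ j),
    ← Finset.mul_prod_erase _ _ (Finset.mem_erase.2 ⟨hij, Finset.mem_univ i⟩)]
  have hcard : ((Finset.univ.erase j).erase i).card = N - 2 := by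
    rw [Finset.card_erase_of_mem (Finset.mem_erase.2 ⟨hij, Finset.mem_univ i⟩),
      Finset.card_erase_of_mem (Finset.mem_univ j), Finset.card_univ, Fintype.card_fin]
    lia
  have hD : 0 ≤ maxDist x / B := div_nonneg
    ((absVal_nonneg _).trans (absVal_sub_le_maxDist x hij)) hB.le
  have hr : 0 ≤ stdNorm x / B := div_nonneg
    ((absVal_nonneg _).trans (absVal_le_stdNorm x i)) hB.le
  have hprod : ((maxDist x / B) ^ (γ - 1)) ^ (N - 2) ≤
      ∏ k ∈ (Finset.univ.erase j).erase i, (absVal (shear j x k) / B) ^ (γ - 1) := by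
    rw [← hcard, ← Finset.prod_const]
    refine Finset.prod_le_prod (fun _ _ => Real.rpow_nonneg hD _) fun k hk => ?_
    have hkj : k ≠ j := Finset.ne_of_mem_erase (Finset.mem_of_mem_erase hk)
    simp only [shear, hkj, if_false]
    exact hle (absVal_pos (sub_ne_zero.2 (hinj k j hkj))) (absVal_sub_le_maxDist x hkj)
  have h1 : (stdNorm x / B) ^ (γ - 1) ≤ (absVal (shear j x j) / B) ^ (γ - 1) := by
    simp only [shear, if_true]
    exact hle (absVal_pos (hx j)) (absVal_le_stdNorm x j)
  have h2 : (absVal (x i - x j) / B) ^ (γ - 1) = (absVal (shear j x i) / B) ^ (γ - 1) := by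
    simp only [shear, hij, if_false]
  rw [h2]
  exact mul_le_mul h1 (mul_le_mul_of_nonneg_left hprod (hnn i))
    (mul_nonneg (hnn i) (pow_nonneg (Real.rpow_nonneg hD _) _)) (hnn j)

theorem stdNorm_le_of_ne_zero [Nonempty (Fin N)] {ρ : ℝ → ℝ} {M : ℤ}
    (hM : ∀ m : ℤ, ρ ((residueCard K : ℝ) ^ m) ≠ 0 → m ≤ M) {x : Fin N → K}
    (hx : ∀ i, x i ≠ 0) (hρ : ρ (stdNorm x) ≠ 0) : stdNorm x ≤ (residueCard K : ℝ) ^ M := by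
  obtain ⟨m, hm⟩ := exists_stdNorm_eq_zpow hx
  rw [hm] at hρ ⊢
  exact zpow_le_zpow_right₀ (by exact_mod_cast (one_lt_residueCard K).le) (hM m hρ)

theorem scaledProd_rpow_le (hN : 2 ≤ N) {B : ℝ} (hB : 0 < B) {c : Fin N → ℝ} (hc : ∀ i, 0 < c i)
    {β : ℝ} (hβ : 0 < β) : ∃ δ : ℝ, 0 < δ ∧ ∀ x : Fin N → K, stdNorm x ≤ B →
      scaledProd B c x ^ β ≤ (minDist x / B) ^ δ := by
  have : Nonempty (Fin N) := ⟨⟨0, by lia⟩⟩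
  obtain ⟨k, hk⟩ := Finite.exists_min c
  -- The square of the smallest charge bounds every c i * c j from below, so δ does not depend on
  -- which pair is closest.
  refine ⟨c k * c k * β, by have := hc k; positivity, fun x hx => ?_⟩
  obtain ⟨i, j, hij, hmin⟩ := exists_minDist_eq hN x
  have hle : ∀ i j, absVal (x i - x j) ≤ B := fun i j => (absVal_sub_le_stdNorm x i j).trans hx
  rw [← hmin]
  have h0 : 0 ≤ absVal (x i - x j) / B := div_nonneg (absVal_nonneg _) hB.le
  have h1 : absVal (x i - x j) / B ≤ 1 := div_le_one_of_le₀ (hle i j) hB.le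
  rw [Real.rpow_mul h0]
  refine Real.rpow_le_rpow (scaledProd_nonneg hB c x) ?_ hβ.le
  refine (scaledProd_le hB hc hle hij).trans ?_
  have hck := hc k
  exact Real.rpow_le_rpow_of_exponent_ge' h0 h1 (by positivity)
    (mul_le_mul (hk i) (hk j) hck.le (hc i).le)

theorem scaledProd_eq_zero {B : ℝ} {c : Fin N → ℝ} (hc : ∀ i, 0 < c i)
    {x : Fin N → K} {i j : Fin N} (hij : i < j) (h : x i = x j) : scaledProd B c x = 0 := by
  refine Finset.prod_eq_zero (Finset.mem_univ i) (Finset.prod_eq_zero (Finset.mem_Ioi.2 hij) ?_)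
  rw [h, sub_self, absVal_zero, zero_div, Real.zero_rpow (mul_pos (hc i) (hc j)).ne']

/-- The observable times the weight is dominated by sheared products of powers `> -1`. -/
theorem exists_norm_mul_le (hN : 2 ≤ N) {a b : ℂ} (hb : -1 ≤ b.re)
    (hab : 1 - (N : ℝ) ≤ (a + b).re) {c : Fin N → ℝ} (hc : ∀ i, 0 < c i) {ρ : ℝ → ℝ}
    (hρ : MildGrowth ρ) {M : ℤ} (hM : ∀ m : ℤ, ρ ((residueCard K : ℝ) ^ m) ≠ 0 → m ≤ M)
    {β : ℝ} (hβ : 0 < β) : ∃ C γ : ℝ, 0 < γ ∧ ∀ x : Fin N → K, (∀ i, x i ≠ 0) →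
      ‖(maxDist x : ℂ) ^ a * (minDist x : ℂ) ^ b‖ *
        (|ρ (stdNorm x)| * scaledProd ((residueCard K : ℝ) ^ M) c x ^ β) ≤
      C * ∑ j, ∏ k, ({x : K | absVal x ≤ (residueCard K : ℝ) ^ M}.indicator
        fun x => (absVal x / (residueCard K : ℝ) ^ M) ^ (γ - 1)) (shear j x k) := by
  have : Nonempty (Fin N) := ⟨⟨0, by lia⟩⟩
  have hB : (0 : ℝ) < (residueCard K : ℝ) ^ M :=
    zpow_pos (by exact_mod_cast (one_lt_residueCard K).le) M
  obtain ⟨δ, hδ, hδle⟩ := scaledProd_rpow_le (K := K) hN hB hc hβ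
  -- The bound 1 keeps γ - 1 ≤ 0 for `le_prod_shear`; δ / (N + 1) is the budget in
  -- `rpow_bound_of_scales`.
  set γ : ℝ := min 1 (δ / (N + 1)) with hγdef
  have hN1 : (0 : ℝ) < N + 1 := by positivity
  have hγ : 0 < γ := lt_min one_pos (div_pos hδ hN1)
  have hγδ : γ * (N + 1) ≤ δ := (le_div_iff₀ hN1).1 (min_le_right _ _)
  obtain ⟨C, hC, hCle⟩ := hρ.exists_bound (one_lt_residueCard K) M hγ
  generalize hBdef : (residueCard K : ℝ) ^ M = B at *
  refine ⟨B ^ (a.re + b.re) * C, γ, hγ, fun x hx => ?_⟩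
  have hterm : ∀ j : Fin N, 0 ≤ ∏ k, ({x : K | absVal x ≤ B}.indicator
      fun x => (absVal x / B) ^ (γ - 1)) (shear j x k) := fun j =>
    Finset.prod_nonneg fun k _ => Set.indicator_nonneg
      (fun y _ => Real.rpow_nonneg (div_nonneg (absVal_nonneg y) hB.le) _) _
  have hrhs : 0 ≤ B ^ (a.re + b.re) * C * ∑ j, ∏ k, ({x : K | absVal x ≤ B}.indicator
      fun x => (absVal x / B) ^ (γ - 1)) (shear j x k) :=
    mul_nonneg (by positivity) (Finset.sum_nonneg fun j _ => hterm j)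
  by_cases hρ0 : ρ (stdNorm x) = 0
  · simpa [hρ0] using hrhs
  by_cases hinj : ∀ i j, i < j → x i ≠ x j
  swap
  -- When particles collide the weight vanishes, whatever value the complex power takes at 0.
  · push Not at hinj
    obtain ⟨i, j, hij, h⟩ := hinj
    rw [scaledProd_eq_zero hc hij h, Real.zero_rpow hβ.ne']
    simpa using hrhs
  have hinj' : ∀ i j, i ≠ j → x i ≠ x j := fun i j hij =>
    (lt_or_gt_of_ne hij).elim (hinj i j) fun h => (hinj j i h).symm
  have hrB : stdNorm x ≤ B := hBdef ▸ stdNorm_le_of_ne_zero hM hx hρ0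
  obtain ⟨m, hm⟩ := exists_stdNorm_eq_zpow hx
  have hρle : |ρ (stdNorm x)| ≤ C * (stdNorm x / B) ^ (-1 - γ) := by
    rw [hm] at hρ0 ⊢
    exact hCle m (hM m hρ0)
  obtain ⟨i, j, hij, hmin⟩ := exists_minDist_eq hN x
  have ht : 0 < minDist x := hmin ▸ absVal_pos (sub_ne_zero.2 (hinj i j hij))
  have htD := minDist_le_maxDist hN x
  have hDr := maxDist_le_stdNorm hN x
  have hD : 0 < maxDist x := ht.trans_le htD
  have hr : 0 < stdNorm x := hD.trans_le hDr
  have h1 := norm_cpow_mul_cpow_le (a := a) hb hab hB ht htD (hDr.trans hrB)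
  have h2 := hδle x hrB
  have h3 := rpow_bound_of_scales hN (div_pos ht hB) (by gcongr : minDist x / B ≤ maxDist x / B)
    (by gcongr : maxDist x / B ≤ stdNorm x / B) (div_le_one_of_le₀ hrB hB.le) hγ hγδ
  have h4 := le_prod_shear hB (min_le_left 1 (δ / (N + 1))) hx hrB hinj' hij.ne
  rw [← hγdef, hmin] at h4
  have hP := scaledProd_nonneg hB c x
  calc ‖(maxDist x : ℂ) ^ a * (minDist x : ℂ) ^ b‖ *
        (|ρ (stdNorm x)| * scaledProd B c x ^ β)
      ≤ (B ^ (a.re + b.re) * ((maxDist x / B) ^ (2 - N : ℝ) * (minDist x / B) ^ (-1 : ℝ))) *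
        ((C * (stdNorm x / B) ^ (-1 - γ)) * (minDist x / B) ^ δ) := by gcongr
    _ = B ^ (a.re + b.re) * C * ((stdNorm x / B) ^ (-1 - γ) *
        ((maxDist x / B) ^ (2 - N : ℝ) * (minDist x / B) ^ (-1 : ℝ)) *
        (minDist x / B) ^ δ) := by ring
    _ ≤ _ := by
        refine mul_le_mul_of_nonneg_left (h3.trans (h4.trans ?_)) (by positivity)
        exact Finset.single_le_sum (f := fun j => ∏ k, ({x : K | absVal x ≤ B}.indicator
          fun x => (absVal x / B) ^ (γ - 1)) (shear j x k)) (fun j _ => hterm j)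
          (Finset.mem_univ j)

theorem measurable_observable (a b : ℂ) :
    Measurable fun x : Fin N → K => (maxDist x : ℂ) ^ a * (minDist x : ℂ) ^ b :=
  ((Complex.measurable_ofReal.comp measurable_maxDist).pow_const a).mul
    ((Complex.measurable_ofReal.comp measurable_minDist).pow_const b)

theorem integrable_scaled (hN : 2 ≤ N) {a b : ℂ} (hb : -1 ≤ b.re)
    (hab : 1 - (N : ℝ) ≤ (a + b).re) {c : Fin N → ℝ} (hc : ∀ i, 0 < c i) {ρ : ℝ → ℝ}
    (hρ : MildGrowth ρ) {M : ℤ} (hM : ∀ m : ℤ, ρ ((residueCard K : ℝ) ^ m) ≠ 0 → m ≤ M)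
    {β : ℝ} (hβ : 0 < β) :
    Integrable (fun x : Fin N → K =>
      (ρ (stdNorm x) * scaledProd ((residueCard K : ℝ) ^ M) c x ^ β) •
        ((maxDist x : ℂ) ^ a * (minDist x : ℂ) ^ b)) (Measure.pi fun _ => haar K) := by
  have : Nonempty (Fin N) := ⟨⟨0, by lia⟩⟩
  have hB : (0 : ℝ) < (residueCard K : ℝ) ^ M :=
    zpow_pos (by exact_mod_cast (one_lt_residueCard K).le) M
  obtain ⟨C, γ, hγ, h⟩ := exists_norm_mul_le (K := K) hN hb hab hc hρ hM hβ
  refine ((integrable_sum_prod_shear M hγ).const_mul C).mono' ?_ ?_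
  · exact (((measurable_comp_stdNorm ρ).mul ((measurable_scaledProd _ c).pow_const β)).smul
      (measurable_observable a b)).aestronglyMeasurable
  · filter_upwards [ae_coord_ne_zero (K := K) (N := N)] with x hx
    refine le_trans (le_of_eq ?_) (h x hx)
    rw [norm_smul, Real.norm_eq_abs, abs_mul,
      abs_of_nonneg (Real.rpow_nonneg (scaledProd_nonneg hB c x) β), mul_comm]

end Domination

/-! ### Concentration on the maximally spread configurations. -/

section Concentration

variable {K : Type*} [Field K] [ValuativeRel K] [TopologicalSpace K]
  [IsNonarchimedeanLocalField K] [MeasurableSpace K] [BorelSpace K] {N : ℕ}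

variable (K N) in
/-- The microstates in the ball of radius `B` whose particles are at mutual distance `B`. -/
def spreadSet (B : ℝ) : Set (Fin N → K) :=
  {x | (∀ i, absVal (x i) ≤ B) ∧ ∀ i j, i ≠ j → absVal (x i - x j) = B}

theorem isOpen_spreadSet (M : ℤ) : IsOpen (spreadSet K N ((residueCard K : ℝ) ^ M)) := by
  obtain ⟨y, hy, h⟩ := exists_absVal_eq_zpow K M
  rw [← h]
  have e : spreadSet K N (absVal y) = (⋂ i, {x | absVal (x i) ≤ absVal y}) ∩
      ⋂ i, ⋂ j, ⋂ (_ : i ≠ j), {x | absVal (x i - x j) = absVal y} := by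
    ext x
    simp [spreadSet]
  rw [e]
  refine (isOpen_iInter_of_finite fun i => ?_).inter (isOpen_iInter_of_finite fun i =>
    isOpen_iInter_of_finite fun j => isOpen_iInter_of_finite fun _ => ?_)
  · exact (isOpen_absVal_le hy).preimage
      (f := fun x : Fin N → K => x i) (by fun_prop)
  · exact (isOpen_absVal_eq y hy).preimage
      (f := fun x : Fin N → K => x i - x j) (by fun_prop)

/-- Here N ≤ q enters: N distinct residue classes give points at mutual distance 1, which are then
rescaled. -/
theorem nonempty_spreadSet (hq : N ≤ residueCard K) (M : ℤ) :
    (spreadSet K N ((residueCard K : ℝ) ^ M)).Nonempty := by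
  obtain ⟨y, hy, h⟩ := exists_absVal_eq_zpow K M
  obtain ⟨x, hx1, hx2⟩ := exists_absVal_sub_eq_one (K := K) hq
  refine ⟨fun i => y * x i, fun i => ?_, fun i j hij => ?_⟩
  · rw [absVal_mul, h]
    exact mul_le_of_le_one_right (h ▸ absVal_nonneg y) (hx1 i)
  · rw [← mul_sub, absVal_mul, hx2 i j hij, mul_one, h]

theorem measure_spreadSet_lt_top (M : ℤ) :
    Measure.pi (fun _ : Fin N => haar K) (spreadSet K N ((residueCard K : ℝ) ^ M)) < ∞ := by
  have hsub : spreadSet K N ((residueCard K : ℝ) ^ M) ⊆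
      Set.univ.pi fun _ => {x : K | absVal x ≤ (residueCard K : ℝ) ^ M} :=
    fun x hx i _ => hx.1 i
  refine (measure_mono hsub).trans_lt ?_
  rw [Measure.pi_pi]
  exact ENNReal.prod_lt_top fun i _ => by rw [haar_absVal_le_zpow]; exact ENNReal.ofReal_lt_top

theorem measure_spreadSet_pos (hq : N ≤ residueCard K) (M : ℤ) :
    0 < Measure.pi (fun _ : Fin N => haar K) (spreadSet K N ((residueCard K : ℝ) ^ M)) := by
  have := secondCountableTopology K
  exact (isOpen_spreadSet M).measure_pos _ (nonempty_spreadSet hq M)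

theorem stdNorm_eq_of_mem_spreadSet (hN : 2 ≤ N) {B : ℝ} {x : Fin N → K}
    (hx : x ∈ spreadSet K N B) : stdNorm x = B := by
  have : Nonempty (Fin N) := ⟨⟨0, by lia⟩⟩
  refine le_antisymm (ciSup_le hx.1) ?_
  have h := hx.2 ⟨0, by lia⟩ ⟨1, by lia⟩ (by simp)
  exact h ▸ absVal_sub_le_stdNorm x _ _

theorem maxDist_eq_of_mem_spreadSet (hN : 2 ≤ N) {B : ℝ} {x : Fin N → K}
    (hx : x ∈ spreadSet K N B) : maxDist x = B := by
  have := nonempty_pairs hN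
  exact (iSup_congr fun p => hx.2 _ _ p.2.ne).trans ciSup_const

theorem minDist_eq_of_mem_spreadSet (hN : 2 ≤ N) {B : ℝ} {x : Fin N → K}
    (hx : x ∈ spreadSet K N B) : minDist x = B := by
  have := nonempty_pairs hN
  exact (iInf_congr fun p => hx.2 _ _ p.2.ne).trans ciInf_const

/-- Where ρ(‖x‖) ≠ 0, almost everywhere the base of the β-th power lies in [0, 1]. The integrand
thus converges to its restriction to `spreadSet`, and for β ≥ 1 its norm is at most that at β = 1.
-/
theorem tendsto_integral_scaled (hN : 2 ≤ N) {a b : ℂ} (hb : -1 ≤ b.re)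
    (hab : 1 - (N : ℝ) ≤ (a + b).re) {c : Fin N → ℝ} (hc : ∀ i, 0 < c i) {ρ : ℝ → ℝ}
    (hρ : MildGrowth ρ) {M : ℤ} (hM : ∀ m : ℤ, ρ ((residueCard K : ℝ) ^ m) ≠ 0 → m ≤ M) :
    Tendsto (fun β : ℝ => ∫ x : Fin N → K,
      (ρ (stdNorm x) * scaledProd ((residueCard K : ℝ) ^ M) c x ^ β) •
        ((maxDist x : ℂ) ^ a * (minDist x : ℂ) ^ b) ∂(Measure.pi fun _ => haar K)) atTop
      (𝓝 ((Measure.pi fun _ : Fin N => haar K).real (spreadSet K N ((residueCard K : ℝ) ^ M)) •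
        (ρ ((residueCard K : ℝ) ^ M) • ((((residueCard K : ℝ) ^ M : ℝ) : ℂ) ^ a *
          (((residueCard K : ℝ) ^ M : ℝ) : ℂ) ^ b)))) := by
  have : Nonempty (Fin N) := ⟨⟨0, by lia⟩⟩
  have := secondCountableTopology K
  have hB : (0 : ℝ) < (residueCard K : ℝ) ^ M :=
    zpow_pos (by exact_mod_cast (one_lt_residueCard K).le) M
  rw [← integral_indicator_const _ (isOpen_spreadSet M).measurableSet]
  refine tendsto_integral_filter_of_dominated_convergence
    (fun x => ‖(ρ (stdNorm x) * scaledProd ((residueCard K : ℝ) ^ M) c x ^ (1 : ℝ)) •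
        ((maxDist x : ℂ) ^ a * (minDist x : ℂ) ^ b)‖) ?_ ?_ ?_ ?_
  · exact Eventually.of_forall fun β => (((measurable_comp_stdNorm ρ).mul
      ((measurable_scaledProd _ c).pow_const β)).smul
      (measurable_observable a b)).aestronglyMeasurable
  · filter_upwards [eventually_ge_atTop 1] with β hβ
    filter_upwards [ae_coord_ne_zero (K := K) (N := N)] with x hx
    rw [norm_smul, norm_smul, norm_mul, norm_mul (ρ (stdNorm x)) (_ ^ (1 : ℝ))]
    by_cases hρ0 : ρ (stdNorm x) = 0
    · simp [hρ0]
    have hrB := stdNorm_le_of_ne_zero hM hx hρ0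
    have hle := fun i j => (absVal_sub_le_stdNorm x i j).trans hrB
    have hP := scaledProd_nonneg hB c x
    gcongr ?_ * ?_ * _
    rw [Real.norm_of_nonneg (by positivity), Real.norm_of_nonneg (by positivity)]
    exact Real.rpow_le_rpow_of_exponent_ge' hP (scaledProd_le_one hB hc hle) zero_le_one hβ
  · exact (integrable_scaled hN hb hab hc hρ hM one_pos).norm
  · filter_upwards [ae_coord_ne_zero (K := K) (N := N)] with x hx
    by_cases hxs : x ∈ spreadSet K N ((residueCard K : ℝ) ^ M)
    · have h1 : scaledProd ((residueCard K : ℝ) ^ M) c x = 1 := by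
        refine (scaledProd_eq_one_iff hB hc fun i j => ?_).2 hxs.2
        exact (absVal_sub_le_stdNorm x i j).trans (stdNorm_eq_of_mem_spreadSet hN hxs).le
      simp only [h1, Real.one_rpow, mul_one, Set.indicator_of_mem hxs,
        stdNorm_eq_of_mem_spreadSet hN hxs, maxDist_eq_of_mem_spreadSet hN hxs,
        minDist_eq_of_mem_spreadSet hN hxs]
      exact tendsto_const_nhds
    · rw [Set.indicator_of_notMem hxs]
      by_cases hρ0 : ρ (stdNorm x) = 0
      · simp [hρ0]
      have hrB := stdNorm_le_of_ne_zero hM hx hρ0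
      have hle := fun i j => (absVal_sub_le_stdNorm x i j).trans hrB
      have hlt : scaledProd ((residueCard K : ℝ) ^ M) c x < 1 := by
        refine lt_of_le_of_ne (scaledProd_le_one hB hc hle) fun h => hxs ⟨fun i => ?_, ?_⟩
        · exact (absVal_le_stdNorm x i).trans hrB
        · exact (scaledProd_eq_one_iff hB hc hle).1 h
      have h0 := scaledProd_nonneg hB c x
      have ht := tendsto_rpow_atTop_of_base_lt_one _ (by linarith) hlt
      simpa using (ht.const_mul (ρ (stdNorm x))).smul_const
        ((maxDist x : ℂ) ^ a * (minDist x : ℂ) ^ b)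

end Concentration

/-! ### The partition function and integration against the gas law. -/

section GasLaw

variable {K : Type*} [Field K] [ValuativeRel K] [TopologicalSpace K]
  [IsNonarchimedeanLocalField K] [MeasurableSpace K] [BorelSpace K] {N : ℕ}

theorem weight_nonneg (hN : 2 ≤ N) {ρ : ℝ → ℝ} (hρ : ∀ t ∈ normValues, 0 ≤ ρ t) (c : Fin N → ℝ)
    (β : ℝ) (x : Fin N → K) : 0 ≤ weight ρ c β x := by
  have : Nonempty (Fin N) := ⟨⟨0, by lia⟩⟩
  exact mul_nonneg (hρ _ (stdNorm_mem_normValues x)) (Finset.prod_nonneg fun _ _ =>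
    Finset.prod_nonneg fun _ _ => Real.rpow_nonneg (absVal_nonneg _) _)

theorem measurable_weight (hN : 2 ≤ N) (ρ : ℝ → ℝ) (c : Fin N → ℝ) (β : ℝ) :
    Measurable (weight ρ c β : (Fin N → K) → ℝ) := by
  have : Nonempty (Fin N) := ⟨⟨0, by lia⟩⟩
  exact (measurable_comp_stdNorm ρ).mul (Finset.measurable_fun_prod _ fun i _ =>
    Finset.measurable_fun_prod _ fun j _ => (measurable_coord_absVal_sub i j).pow_const _)

theorem integrable_weight_smul (hN : 2 ≤ N) {a b : ℂ} (hb : -1 ≤ b.re)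
    (hab : 1 - (N : ℝ) ≤ (a + b).re) {c : Fin N → ℝ} (hc : ∀ i, 0 < c i) {ρ : ℝ → ℝ}
    (hρ : MildGrowth ρ) {M : ℤ} (hM : ∀ m : ℤ, ρ ((residueCard K : ℝ) ^ m) ≠ 0 → m ≤ M)
    {β : ℝ} (hβ : 0 < β) :
    Integrable (fun x : Fin N → K => weight ρ c β x •
        ((maxDist x : ℂ) ^ a * (minDist x : ℂ) ^ b)) (Measure.pi fun _ => haar K) := by
  have hB : (0 : ℝ) < (residueCard K : ℝ) ^ M :=
    zpow_pos (by exact_mod_cast (one_lt_residueCard K).le) M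
  simp_rw [weight_eq hB, mul_smul]
  simpa only [mul_smul] using (integrable_scaled hN hb hab hc hρ hM hβ).fun_smul
    ((∏ i, ∏ j ∈ Finset.Ioi i, ((residueCard K : ℝ) ^ M) ^ (c i * c j)) ^ β)

theorem integrable_weight (hN : 2 ≤ N) {c : Fin N → ℝ} (hc : ∀ i, 0 < c i) {ρ : ℝ → ℝ}
    (hρ : MildGrowth ρ) {M : ℤ} (hM : ∀ m : ℤ, ρ ((residueCard K : ℝ) ^ m) ≠ 0 → m ≤ M)
    {β : ℝ} (hβ : 0 < β) :
    Integrable (weight ρ c β : (Fin N → K) → ℝ) (Measure.pi fun _ => haar K) := by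
  have hN' : (2 : ℝ) ≤ N := by exact_mod_cast hN
  -- The zero exponents are admissible since 1 - N ≤ 0, and make the observable identically 1.
  have h := integrable_weight_smul (K := K) hN (a := 0) (b := 0) (by simp)
    (by simp; linarith) hc hρ hM hβ
  simpa using h.re

theorem integral_weight_pos (hN : 2 ≤ N) (hq : N ≤ residueCard K) {c : Fin N → ℝ}
    (hc : ∀ i, 0 < c i) {ρ : ℝ → ℝ} (hρ0 : ∀ t ∈ normValues, 0 ≤ ρ t)
    (hρ : MildGrowth ρ) {M : ℤ} (hM : IsGreatest {m : ℤ | ρ ((residueCard K : ℝ) ^ m) ≠ 0} M)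
    {β : ℝ} (hβ : 0 < β) :
    0 < ∫ x : Fin N → K, weight ρ c β x ∂(Measure.pi fun _ => haar K) := by
  have hB : (0 : ℝ) < (residueCard K : ℝ) ^ M :=
    zpow_pos (by exact_mod_cast (one_lt_residueCard K).le) M
  rw [integral_pos_iff_support_of_nonneg (weight_nonneg hN hρ0 c β)
    (integrable_weight hN hc hρ hM.2 hβ)]
  refine (measure_spreadSet_pos hq M).trans_le (measure_mono fun x hx => ?_)
  have h1 : scaledProd ((residueCard K : ℝ) ^ M) c x = 1 := by
    refine (scaledProd_eq_one_iff hB hc fun i j => ?_).2 hx.2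
    exact (absVal_sub_le_stdNorm x i j).trans (stdNorm_eq_of_mem_spreadSet hN hx).le
  rw [Function.mem_support, weight_eq hB, h1, Real.one_rpow, mul_one,
    stdNorm_eq_of_mem_spreadSet hN hx]
  refine mul_ne_zero (Real.rpow_pos_of_pos ?_ β).ne' hM.1
  exact Finset.prod_pos fun _ _ => Finset.prod_pos fun _ _ => Real.rpow_pos_of_pos hB _

theorem partitionFunction_eq (hN : 2 ≤ N) {c : Fin N → ℝ}
    {ρ : ℝ → ℝ} (hρ0 : ∀ t ∈ normValues, 0 ≤ ρ t) {β : ℝ}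
    (hint : Integrable (weight ρ c β : (Fin N → K) → ℝ) (Measure.pi fun _ => haar K)) :
    partitionFunction K ρ c β =
      ENNReal.ofReal (∫ x : Fin N → K, weight ρ c β x ∂(Measure.pi fun _ => haar K)) :=
  (ofReal_integral_eq_lintegral_ofReal hint
    (Eventually.of_forall (weight_nonneg hN hρ0 c β))).symm

theorem integral_gasLaw (hN : 2 ≤ N) {c : Fin N → ℝ}
    {ρ : ℝ → ℝ} (hρ0 : ∀ t ∈ normValues, 0 ≤ ρ t) {β : ℝ}
    (hint : Integrable (weight ρ c β : (Fin N → K) → ℝ) (Measure.pi fun _ => haar K))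
    (f : (Fin N → K) → ℂ) :
    ∫ x, f x ∂(gasLaw K ρ c β) =
      (∫ x : Fin N → K, weight ρ c β x ∂(Measure.pi fun _ => haar K))⁻¹ •
        ∫ x, weight ρ c β x • f x ∂(Measure.pi fun _ => haar K) := by
  have h0 : 0 ≤ ∫ x : Fin N → K, weight ρ c β x ∂(Measure.pi fun _ => haar K) :=
    integral_nonneg (weight_nonneg hN hρ0 c β)
  rw [gasLaw, integral_smul_measure, partitionFunction_eq hN hρ0 hint, ENNReal.toReal_inv,
    ENNReal.toReal_ofReal h0, integral_withDensity_eq_integral_toReal_smul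
      (measurable_weight hN ρ c β).ennreal_ofReal
      (Eventually.of_forall fun _ => ENNReal.ofReal_lt_top)]
  simp_rw [ENNReal.toReal_ofReal (weight_nonneg hN hρ0 c β _)]

end GasLaw

end LogCoulombGas

open LogCoulombGas in
theorem mainTheorem5 (K : Type*) [Field K] [ValuativeRel K] [TopologicalSpace K]
    [IsNonarchimedeanLocalField K] [MeasurableSpace K] [BorelSpace K]
    (N : ℕ) (hN : 2 ≤ N) (hq : N ≤ LogCoulombGas.residueCard K)
    (a b : ℂ) (hb : -1 ≤ b.re) (hab : 1 - (N : ℝ) ≤ (a + b).re)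
    (c : Fin N → ℝ) (hc : ∀ i, 0 < c i)
    (ρ : ℝ → ℝ) (hρ_nonneg : ∀ t ∈ LogCoulombGas.normValues, 0 ≤ ρ t)
    (hρ_growth : LogCoulombGas.MildGrowth ρ)
    (hρ_supp : HasCompactSupport fun x : Fin N → K => ρ (LogCoulombGas.stdNorm x))
    (M : ℤ) (hM : IsGreatest {m : ℤ | ρ ((LogCoulombGas.residueCard K : ℝ) ^ m) ≠ 0} M) :
    (∀ β : ℝ, 0 < β →
      IsProbabilityMeasure (LogCoulombGas.gasLaw K ρ c β) ∧
      Integrable (fun x : Fin N → K =>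
        (LogCoulombGas.maxDist x : ℂ) ^ a * (LogCoulombGas.minDist x : ℂ) ^ b)
        (LogCoulombGas.gasLaw K ρ c β)) ∧
    Tendsto (fun β : ℝ => ∫ x : Fin N → K,
        (LogCoulombGas.maxDist x : ℂ) ^ a * (LogCoulombGas.minDist x : ℂ) ^ b
        ∂(LogCoulombGas.gasLaw K ρ c β))
      atTop (𝓝 ((LogCoulombGas.residueCard K : ℂ) ^ ((M : ℂ) * (a + b)))) := by
  have hq0 : (0 : ℝ) < residueCard K := by exact_mod_cast (one_lt_residueCard K).le
  have hB : (0 : ℝ) < (residueCard K : ℝ) ^ M := zpow_pos hq0 M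
  refine ⟨fun β hβ => ?_, ?_⟩
  · have hint := integrable_weight (K := K) hN hc hρ_growth hM.2 hβ
    have hZ := partitionFunction_eq hN hρ_nonneg hint
    have hpos := integral_weight_pos hN hq hc hρ_nonneg hρ_growth hM hβ
    have hZ0 : partitionFunction K ρ c β ≠ 0 := by
      rw [hZ]
      exact (ENNReal.ofReal_pos.2 hpos).ne'
    have hZt : partitionFunction K ρ c β ≠ ∞ := hZ ▸ ENNReal.ofReal_ne_top
    refine ⟨⟨?_⟩, ?_⟩
    · rw [gasLaw, Measure.smul_apply, withDensity_apply _ MeasurableSet.univ,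
        Measure.restrict_univ, smul_eq_mul]
      exact ENNReal.inv_mul_cancel hZ0 hZt
    · refine Integrable.smul_measure ?_ (ENNReal.inv_ne_top.2 hZ0)
      rw [integrable_withDensity_iff_integrable_smul' (measurable_weight hN ρ c β).ennreal_ofReal
        (Eventually.of_forall fun _ => ENNReal.ofReal_lt_top)]
      simp_rw [ENNReal.toReal_ofReal (weight_nonneg hN hρ_nonneg c β _)]
      exact integrable_weight_smul hN hb hab hc hρ_growth hM.2 hβ
  · have hN' : (2 : ℝ) ≤ N := by exact_mod_cast hN
    have hnum := tendsto_integral_scaled (K := K) hN hb hab hc hρ_growth hM.2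
    have hden := tendsto_integral_scaled (K := K) hN (a := 0) (b := 0) (by simp)
      (by simp; linarith) hc hρ_growth hM.2
    have hvol : 0 < (Measure.pi fun _ : Fin N => haar K).real
        (spreadSet K N ((residueCard K : ℝ) ^ M)) :=
      ENNReal.toReal_pos (measure_spreadSet_pos hq M).ne' (measure_spreadSet_lt_top M).ne
    have hρM : ρ ((residueCard K : ℝ) ^ M) ≠ 0 := hM.1
    have hlim := hnum.div hden (by simp [hvol.ne', hρM])
    have hqM : (((residueCard K : ℝ) ^ M : ℝ) : ℂ) ^ a * (((residueCard K : ℝ) ^ M : ℝ) : ℂ) ^ b =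
        (residueCard K : ℂ) ^ ((M : ℂ) * (a + b)) := by
      rw [← Complex.cpow_add _ _ (by exact_mod_cast hB.ne')]
      -- The bases are positive reals, so no branch of the logarithm interferes.
      have hlog : Complex.log (((residueCard K : ℝ) ^ M : ℝ) : ℂ) =
          M * Complex.log (residueCard K : ℂ) := by
        rw [← Complex.ofReal_log hB.le, Real.log_zpow, ← Complex.natCast_log]
        push_cast
        rfl
      rw [Complex.cpow_def_of_ne_zero (by exact_mod_cast hB.ne'),
        Complex.cpow_def_of_ne_zero (by exact_mod_cast hq0.ne'), hlog]
      congr 1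
      ring
    have hval : (Measure.pi fun _ : Fin N => haar K).real
        (spreadSet K N ((residueCard K : ℝ) ^ M)) • (ρ ((residueCard K : ℝ) ^ M) •
          ((((residueCard K : ℝ) ^ M : ℝ) : ℂ) ^ a * (((residueCard K : ℝ) ^ M : ℝ) : ℂ) ^ b)) /
        (Measure.pi fun _ : Fin N => haar K).real
        (spreadSet K N ((residueCard K : ℝ) ^ M)) • (ρ ((residueCard K : ℝ) ^ M) •
          ((((residueCard K : ℝ) ^ M : ℝ) : ℂ) ^ (0 : ℂ) *
            (((residueCard K : ℝ) ^ M : ℝ) : ℂ) ^ (0 : ℂ))) =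
        (residueCard K : ℂ) ^ ((M : ℂ) * (a + b)) := by
      rw [hqM]
      simp only [Complex.cpow_zero, mul_one, Complex.real_smul]
      have h1 := Complex.ofReal_ne_zero.2 hvol.ne'
      have h2 := Complex.ofReal_ne_zero.2 hρM
      field_simp
    rw [hval] at hlim
    refine hlim.congr' ?_
    filter_upwards [eventually_gt_atTop 0] with β hβ
    have hint := integrable_weight (K := K) hN hc hρ_growth hM.2 hβ
    rw [integral_gasLaw hN hρ_nonneg hint]
    -- This factor appears in both the numerator and the partition function; being nonzero, it
    -- cancels.
    have hA : (0 : ℝ) < (∏ i, ∏ j ∈ Finset.Ioi i, ((residueCard K : ℝ) ^ M) ^ (c i * c j)) ^ β :=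
      Real.rpow_pos_of_pos (Finset.prod_pos fun _ _ => Finset.prod_pos fun _ _ =>
        Real.rpow_pos_of_pos hB _) _
    simp only [weight_eq hB, Complex.cpow_zero, mul_one, Complex.real_smul, Complex.ofReal_mul,
      Complex.ofReal_inv, integral_const_mul, Pi.div_apply, mul_assoc,
      ← integral_complex_ofReal]
    have hA' := Complex.ofReal_ne_zero.2 hA.ne'
    field_simp
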